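/- Let $n\ge 2$, let $\Omega\subset\mathbb{R}^n$ be a bounded open set with $C^2$ boundary, let $T>0$ and $Q:=(0,T)\times\Omega$. Let $q=(q_{ij})_{1\le i,j\le n}$ be a complex matrix-valued function on $Q$ with every $q_{ij}\in W^{1,\infty}(Q)$, and let $q^*=\overline{q}^{\,T}$ be its pointwise adjoint. For a complex matrix potential $p$ and $\vec v=(v_1,\dots,v_n)$ write $$(\mathcal{L}_{p}\vec v)_i:=(\partial_t^2-\Delta_x)v_i+\sum_{j=1}^n p_{ij}v_j,\qquad 1\le i\le n .$$ Fix $\omega\in\mathbb{R}^n$ with $|\omega|=1$ and put $\varphi(t,x):=t+x\cdot\omega$. Then there exists $h_0>0$ such that for every $\zeta\in\mathbb{R}^{1+n}$ with $\zeta\cdot(1,-\omega)=0$ and every constant vector $\vec K_1\in\mathbb{C}^n$ there is a constant $C$, independent of $h$, with the following property. For every $0<h\le h_0$ there is $\vec v_d\in H^2(Q)^n$ satisfying $\mathcal{L}_{q^*}\vec v_d=0$ in $Q$ (weak derivatives, equality almost everywhere) of the form $$\vec v_d(t,x)=e^{-\varphi(t,x)/h}\left(e^{-i\zeta\cdot(t,x)}\vec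 K_1+h\,\vec R_d(t,x;h)\right),\qquad (t,x)\in Q,$$ where $\vec R_d(\cdot;h)\in H^2(Q)^n$ and $$\|\vec R_d(\cdot;h)\|_{L^2(Q)}:=\Big(\sum_{j=1}^n\int_Q|R_{d,j}(t,x;h)|^2\,dx\,dt\Big)^{1/2}\le C .$$ -/

import Mathlib

open MeasureTheory Set
open scoped ENNReal Matrix

/-- A set has `C²` boundary: near each boundary point `p` it is the sublevel set `{ρ < 0}` of a
`C²` function `ρ` whose differential does not vanish at `p`. -/
def HasC2Boundary {E : Type*} [NormedAddCommGroup E] [NormedSpace ℝ E] (Ω : Set E) : Prop :=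
  ∀ p ∈ frontier Ω, ∃ (U : Set E) (ρ : E → ℝ), IsOpen U ∧ p ∈ U ∧ ContDiffOn ℝ 2 ρ U ∧
    fderiv ℝ ρ p ≠ 0 ∧ ∀ x ∈ U, x ∈ Ω ↔ ρ x < 0

/-- The function `g` is the weak derivative `∂_v f` on the open set `U` of the locally integrable
function `f` in the direction `v`, tested against smooth functions compactly supported in `U`. -/
def HasWeakDeriv {E : Type*} [NormedAddCommGroup E] [NormedSpace ℝ E] [MeasureSpace E]
    (U : Set E) (v : E) (f g : E → ℂ) : Prop :=
  LocallyIntegrableOn f U volume ∧ LocallyIntegrableOn g U volume ∧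
    ∀ θ : E → ℝ, ContDiff ℝ ((⊤ : ℕ∞) : WithTop ℕ∞) θ → HasCompactSupport θ → tsupport θ ⊆ U →
      ∫ z in U, ((fderiv ℝ θ z v : ℝ) : ℂ) * f z = -∫ z in U, (θ z : ℂ) * g z

/-- Membership in the Sobolev space `W^{k,p}(U)` of complex functions on an open set `U`: the
function lies in `L^p(U)` and so do all its weak derivatives up to order `k`. -/
def MemSobolevOn {E : Type*} [NormedAddCommGroup E] [NormedSpace ℝ E] [MeasureSpace E]
    (U : Set E) (p : ℝ≥0∞) : ℕ → (E → ℂ) → Prop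
  | 0, f => MemLp f p (volume.restrict U)
  | k + 1, f => MemLp f p (volume.restrict U) ∧
      ∀ v : E, ∃ g : E → ℂ, HasWeakDeriv U v f g ∧ MemSobolevOn U p k g

/-- The second-order weak derivative `∂_v ∂_v f = g` on `U`. -/
def HasWeakSecondDeriv {E : Type*} [NormedAddCommGroup E] [NormedSpace ℝ E] [MeasureSpace E]
    (U : Set E) (v : E) (f g : E → ℂ) : Prop :=
  ∃ f' : E → ℂ, HasWeakDeriv U v f f' ∧ HasWeakDeriv U v f' g

/-- Space-time `ℝ × ℝⁿ`, with points `(t, x)`. -/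
abbrev SpaceTime (n : ℕ) : Type := ℝ × EuclideanSpace ℝ (Fin n)

/-- The Euclidean inner product of `ℝ^{1+n}` on space-time. -/
noncomputable def spaceTimeInner {n : ℕ} (ζ z : SpaceTime n) : ℝ :=
  ζ.1 * z.1 + inner ℝ ζ.2 z.2

/-- The cylinder `Q = (0, T) × Ω`. -/
def spaceTimeCylinder {n : ℕ} (T : ℝ) (Ω : Set (EuclideanSpace ℝ (Fin n))) : Set (SpaceTime n) :=
  Ioo 0 T ×ˢ Ω

/-- `□ u = w` almost everywhere on `U`, where `□ = ∂_t² - ∑ₖ ∂_{x_k}²` and all derivatives are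
weak derivatives. -/
def HasWeakBox {n : ℕ} (U : Set (SpaceTime n)) (u w : SpaceTime n → ℂ) : Prop :=
  ∃ (a : SpaceTime n → ℂ) (b : Fin n → SpaceTime n → ℂ),
    HasWeakSecondDeriv U ((1 : ℝ), (0 : EuclideanSpace ℝ (Fin n))) u a ∧
    (∀ k, HasWeakSecondDeriv U ((0 : ℝ), EuclideanSpace.single k (1 : ℝ)) u (b k)) ∧
    ∀ᵐ z ∂(volume.restrict U), w z = a z - ∑ k, b k z

/-- `𝓛_q v = 0` almost everywhere on `U`: `□ v_i + ∑ⱼ q_{ij} v_j = 0` for every `i`. -/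
def SolvesWaveSystem {n : ℕ} (U : Set (SpaceTime n))
    (q : SpaceTime n → Matrix (Fin n) (Fin n) ℂ) (v : SpaceTime n → Fin n → ℂ) : Prop :=
  ∃ w : SpaceTime n → Fin n → ℂ, (∀ i, HasWeakBox U (fun z => v z i) (fun z => w z i)) ∧
    ∀ᵐ z ∂(volume.restrict U), ∀ i, w z i + ∑ j, q z i j * v z j = 0

/-- The vector-valued space `𝐇²(U)`: every component lies in `H²(U) = W^{2,2}(U)`. -/
def MemVectorH2 {n : ℕ} (U : Set (SpaceTime n)) (v : SpaceTime n → Fin n → ℂ) : Prop :=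
  ∀ i, MemSobolevOn U 2 2 (fun z => v z i)

/-- The norm of `𝐋²(U)`, `(∑ⱼ ∫_U |v_j|²)^{1/2}`. -/
noncomputable def vectorL2Norm {n : ℕ} (U : Set (SpaceTime n))
    (v : SpaceTime n → Fin n → ℂ) : ℝ :=
  Real.sqrt (∑ j, ∫ z in U, ‖v z j‖ ^ 2)

/-- The weight `φ(t, x) = t + x · ω`. -/
noncomputable def phase {n : ℕ} (ω : EuclideanSpace ℝ (Fin n)) (z : SpaceTime n) : ℝ :=
  z.1 + inner ℝ z.2 ω

/-- The leading amplitude `B(t, x) = e^{-i ζ·(t,x)} K`. -/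
noncomputable def amplitude {n : ℕ} (ζ : SpaceTime n) (K : Fin n → ℂ)
    (z : SpaceTime n) : Fin n → ℂ :=
  Complex.exp (-Complex.I * (spaceTimeInner ζ z : ℂ)) • K

/-! The solution is built on all of space-time by inverting a Fourier multiplier. Conjugate `□` by
`e^{-φ/h - t}` instead of `e^{-φ/h}`. The symbol becomes `D(ξ) = (2πiξ₀ - (1/h + 1))² - ∑ₖ (2πiξₖ -
ωₖ/h)²`, and the extra `e^{-t}` removes all its zeros: `|D| ≥ 1/h` (`inv_le_norm_waveSymbol`). Hence
the multiplier `G = (hD)⁻¹` has norm at most `1` on `L²`, and `r = G(f - h ∑ⱼ aᵢⱼ rⱼ)` is a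
contraction for small `h`, with `‖r‖ ≤ 2‖f‖` uniformly in `h` (`exists_system_fixedPoint`).

Since `|ω| = 1` and `ζ·(1,-ω) = 0`, the `h⁻²` and `h⁻¹` terms of `□(e^{-φ/h} B)` cancel, leaving `κ
e^{-φ/h} B` with `κ` independent of `h`. With `f = -e^t (κB + q*B)` on `Q` and `R = e^{-t} r`, the
function `e^{-φ/h}(B + hR)` solves the system, and `e^{-t} ≤ 1` on `Q` preserves the bound.

It remains to see that `r` is in `H²`. The symbol is not elliptic of order two; it only satisfies `1
+ |ξ|² ≤ K |D| (1 + |ξ₀|)` (`exists_elliptic_bound_waveSymbol`), so one time derivative of the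
right-hand side `F` is needed. Time translations commute with `G`, and their commutators with
coefficients that are Lipschitz in time are `O(s)`; so the fixed-point equation itself bounds the
time difference quotients of `F` in `L²` (`norm_system_commutator_le`). This requires the entries of
`q` to be extended from `Q` with a Lipschitz bound in time alone, which is obtained from
mollifications (`exists_timeLipschitz_extension`). -/

/-! ### Translations and weak derivatives in `L²` through the Fourier transform. -/

section FourierL2
open scoped FourierTransform
open Filter Topology

variable {E : Type*} [NormedAddCommGroup E] [InnerProductSpace ℝ E] [FiniteDimensional ℝ E]
  [MeasurableSpace E] [BorelSpace E]

/-- Multiplication by a bounded measurable function is a bounded operator on `L²`. -/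
theorem exists_lpMul {α : Type*} [MeasurableSpace α] {μ : Measure α} (m : α → ℂ) (C : ℝ)
    (hC : 0 ≤ C) (hm : AEStronglyMeasurable m μ) (hb : ∀ᵐ x ∂μ, ‖m x‖ ≤ C) :
    ∃ T : Lp ℂ 2 μ →L[ℂ] Lp ℂ 2 μ, ‖T‖ ≤ C ∧ ∀ f : Lp ℂ 2 μ, T f =ᵐ[μ] fun x => m x * f x := by
  have hm' : MemLp m ∞ μ := memLp_top_of_bound hm C hb
  refine ⟨(ContinuousLinearMap.mul ℂ ℂ).holderL μ ∞ 2 2 hm'.toLp, ?_, fun f => ?_⟩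
  · refine ContinuousLinearMap.opNorm_le_bound _ hC fun f => ?_
    refine (ContinuousLinearMap.norm_holder_apply_apply_le _ _ _).trans ?_
    have h1 : ‖ContinuousLinearMap.mul ℂ ℂ‖ ≤ 1 := ContinuousLinearMap.opNorm_mul_le ℂ ℂ
    have h2 : ‖hm'.toLp‖ ≤ C := by
      rw [Lp.norm_toLp]
      refine ENNReal.toReal_le_of_le_ofReal hC ?_
      rw [eLpNorm_exponent_top]
      exact eLpNormEssSup_le_of_ae_bound hb
    calc ‖ContinuousLinearMap.mul ℂ ℂ‖ * ‖hm'.toLp‖ * ‖f‖ ≤ 1 * C * ‖f‖ := by gcongr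
      _ = C * ‖f‖ := by ring
  · filter_upwards [ContinuousLinearMap.coeFn_holder (r := 2) (ContinuousLinearMap.mul ℂ ℂ)
      hm'.toLp f, hm'.coeFn_toLp] with x hx hx'
    change (ContinuousLinearMap.holder 2 (ContinuousLinearMap.mul ℂ ℂ) hm'.toLp f : α → ℂ) x = _
    rw [hx, hx']; rfl

/-- Translation by `a` on `L²(E)`. -/
noncomputable def lpTranslate (a : E) :
    Lp ℂ 2 (volume : Measure E) →ₗᵢ[ℂ] Lp ℂ 2 (volume : Measure E) :=
  Lp.compMeasurePreservingₗᵢ ℂ (fun x => x + a) (measurePreserving_add_right volume a)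

theorem coeFn_lpTranslate (a : E) (f : Lp ℂ 2 (volume : Measure E)) :
    lpTranslate a f =ᵐ[volume] fun x => f (x + a) :=
  Lp.coeFn_compMeasurePreserving f (measurePreserving_add_right volume a)

/-- Both sides are continuous in `f`, so the classical formula for Schwartz functions extends by
density. -/
theorem fourier_lpTranslate (a : E) (f : Lp ℂ 2 (volume : Measure E)) :
    (𝓕 (lpTranslate a f) : Lp ℂ 2 (volume : Measure E)) =ᵐ[volume]
      fun ξ => (Real.fourierChar (inner ℝ a ξ) : ℂ) * (𝓕 f : Lp ℂ 2 (volume : Measure E)) ξ := by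
  obtain ⟨T, -, hT⟩ := exists_lpMul (μ := (volume : Measure E))
    (fun ξ : E => (Real.fourierChar (inner ℝ a ξ) : ℂ)) 1 zero_le_one
    (by
      have : Continuous fun ξ : E => (Real.fourierChar (inner ℝ a ξ) : ℂ) := by fun_prop
      exact this.aestronglyMeasurable) (ae_of_all _ fun ξ => (Circle.norm_coe _).le)
  suffices h : 𝓕 (lpTranslate a f) = T (𝓕 f) by rw [h]; exact hT _
  refine DenseRange.induction_on
    (p := fun f : Lp ℂ 2 (volume : Measure E) => 𝓕 (lpTranslate a f) = T (𝓕 f))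
    (SchwartzMap.denseRange_toLpCLM (p := 2) ENNReal.ofNat_ne_top) f ?_ ?_
  · apply isClosed_eq
    · exact (Lp.fourierTransformₗᵢ E ℂ).continuous.comp (lpTranslate a).continuous
    · exact T.continuous.comp (Lp.fourierTransformₗᵢ E ℂ).continuous
  · intro g
    have h1 : lpTranslate a (g.toLp 2) = ((SchwartzMap.compSubConstCLM ℂ (-a)) g).toLp 2 := by
      apply Lp.ext
      have hq := (quasiMeasurePreserving_add_right (volume : Measure E) a).ae_eq_comp
        (SchwartzMap.coeFn_toLp g 2 volume)
      filter_upwards [coeFn_lpTranslate a (g.toLp 2), hq, SchwartzMap.coeFn_toLp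
        ((SchwartzMap.compSubConstCLM ℂ (-a)) g) 2 volume] with x h1 h2 h3
      rw [h1, h3]
      simpa using h2
    change 𝓕 (lpTranslate a (g.toLp 2)) = T (𝓕 (g.toLp 2))
    rw [h1, SchwartzMap.toLp_fourier_eq, SchwartzMap.toLp_fourier_eq]
    apply Lp.ext
    filter_upwards [hT ((𝓕 g).toLp 2), SchwartzMap.coeFn_toLp (𝓕 g) 2 volume,
      SchwartzMap.coeFn_toLp (𝓕 ((SchwartzMap.compSubConstCLM ℂ (-a)) g)) 2 volume] with ξ h1 h2 h3
    rw [h1, h2, h3, SchwartzMap.fourier_coe, SchwartzMap.fourier_coe]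
    have h4 : ((SchwartzMap.compSubConstCLM ℂ (-a)) g : E → ℂ) = (g : E → ℂ) ∘ fun v => v + a := by
      ext x; simp
    rw [h4]
    have := congrFun (VectorFourier.fourierIntegral_comp_add_right Real.fourierChar
      (volume : Measure E) (innerₗ E) (g : E → ℂ) a) ξ
    exact this

/-- The transforms of the difference quotients are bounded in `L²` by `C` and converge pointwise to
`2πi⟨e,ξ⟩ 𝓕 f`; Fatou's lemma bounds the limit. -/
theorem memLp_inner_mul_fourier_of_lpTranslate_le {e : E} {f : Lp ℂ 2 (volume : Measure E)} {C : ℝ}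
    (hC : ∀ s : ℝ, 0 < s → s ≤ 1 → ‖lpTranslate (s • e) f - f‖ ≤ C * s) :
    MemLp (fun ξ => (inner ℝ e ξ : ℂ) * (𝓕 f : Lp ℂ 2 (volume : Measure E)) ξ) 2 volume := by
  set F : Lp ℂ 2 (volume : Measure E) := 𝓕 f
  let s : ℕ → ℝ := fun k => 1 / ((k : ℝ) + 1)
  have hs0 : ∀ k, 0 < s k := fun k => by positivity
  have hs1 : ∀ k, s k ≤ 1 := fun k => by
    rw [div_le_one (by positivity)]; linarith [Nat.cast_nonneg (α := ℝ) k]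
  have hslim : Tendsto s atTop (𝓝 0) := tendsto_one_div_add_atTop_nhds_zero_nat
  let G : ℕ → Lp ℂ 2 (volume : Measure E) := fun k =>
    ((s k : ℂ)⁻¹) • (𝓕 (lpTranslate (s k • e) f - f))
  have hG : ∀ k, ‖G k‖ ≤ C := fun k => by
    rw [norm_smul, Lp.norm_fourier_eq, norm_inv, Complex.norm_real, Real.norm_of_nonneg (hs0 k).le,
      inv_mul_le_iff₀ (hs0 k), mul_comm]
    exact hC _ (hs0 k) (hs1 k)
  have hGe : ∀ k, G k =ᵐ[volume] fun ξ =>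
      (s k : ℂ)⁻¹ * ((Real.fourierChar (inner ℝ (s k • e) ξ) : ℂ) * F ξ - F ξ) := fun k => by
    have h1 : (𝓕 (lpTranslate (s k • e) f - f) : Lp ℂ 2 (volume : Measure E)) =
        𝓕 (lpTranslate (s k • e) f) - F := (Lp.fourierTransformₗᵢ E ℂ).map_sub _ _
    filter_upwards [Lp.coeFn_smul ((s k : ℂ)⁻¹) (𝓕 (lpTranslate (s k • e) f - f)),
      Lp.coeFn_sub (𝓕 (lpTranslate (s k • e) f)) F, fourier_lpTranslate (s k • e) f] with ξ a b c
    simp only [G]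
    rw [a, Pi.smul_apply, h1, b, Pi.sub_apply, c, smul_eq_mul]
  have hlim : ∀ᵐ ξ ∂(volume : Measure E), Tendsto (fun k => G k ξ) atTop
      (𝓝 ((2 * Real.pi * Complex.I) * ((inner ℝ e ξ : ℂ) * F ξ))) := by
    filter_upwards [ae_all_iff.2 hGe] with ξ hξ
    simp_rw [hξ]
    have hd : HasDerivAt (fun t : ℝ => Complex.exp ((2 * Real.pi * inner ℝ e ξ * Complex.I : ℂ) * t))
        (2 * Real.pi * inner ℝ e ξ * Complex.I : ℂ) 0 := by
      have := (((hasDerivAt_id (0 : ℝ)).ofReal_comp).const_mul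
        (2 * Real.pi * inner ℝ e ξ * Complex.I : ℂ)).cexp
      simpa using this
    have hs' : Tendsto s atTop (𝓝[≠] 0) :=
      tendsto_nhdsWithin_iff.2 ⟨hslim, Eventually.of_forall fun k => (hs0 k).ne'⟩
    have h2 := (hd.tendsto_slope_zero.comp hs').mul_const (F ξ)
    refine (h2.congr fun k => ?_).trans_eq ?_
    · simp only [Function.comp_apply, zero_add, Complex.ofReal_zero, mul_zero, Complex.exp_zero]
      rw [Real.fourierChar_apply, inner_smul_left, Complex.real_smul, Complex.ofReal_inv]
      push_cast
      simp only [conj_trivial]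
      ring_nf
    · congr 1; ring
  have hbd : eLpNorm (fun ξ => (2 * Real.pi * Complex.I) * ((inner ℝ e ξ : ℂ) * F ξ)) 2 volume
      ≤ ENNReal.ofReal C := by
    refine (Lp.eLpNorm_lim_le_liminf_eLpNorm (fun k => (Lp.aestronglyMeasurable (G k))) _ hlim).trans
      ?_
    refine liminf_le_of_frequently_le' (Eventually.frequently (Eventually.of_forall fun k => ?_))
    have := hG k
    rw [Lp.norm_def] at this
    exact (ENNReal.le_ofReal_iff_toReal_le (Lp.eLpNorm_ne_top _)
      ((norm_nonneg _).trans (hG k))).2 this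
  have hm : AEStronglyMeasurable (fun ξ => (inner ℝ e ξ : ℂ) * F ξ) volume := by
    have : Continuous fun ξ : E => (inner ℝ e ξ : ℂ) := by fun_prop
    exact this.aestronglyMeasurable.mul (Lp.aestronglyMeasurable F)
  have hml : MemLp (fun ξ => (2 * Real.pi * Complex.I) * ((inner ℝ e ξ : ℂ) * F ξ)) 2 volume :=
    ⟨hm.const_mul _, hbd.trans_lt ENNReal.ofReal_lt_top⟩
  have := hml.const_mul (2 * Real.pi * Complex.I)⁻¹
  refine this.ae_eq (ae_of_all _ fun ξ => ?_)
  have : (2 * Real.pi * Complex.I : ℂ) ≠ 0 := Complex.two_pi_I_ne_zero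
  simp only
  field_simp

theorem integral_ofReal_mul_eq_inner {Φ : SchwartzMap E ℂ} {ρ : E → ℝ} (hΦ : ∀ z, Φ z = (ρ z : ℂ))
    (g : Lp ℂ 2 (volume : Measure E)) :
    ∫ z, (ρ z : ℂ) * g z = inner ℂ (Φ.toLp 2 volume) g := by
  rw [L2.inner_def]
  refine integral_congr_ae ?_
  filter_upwards [SchwartzMap.coeFn_toLp Φ 2 volume] with z hz
  rw [hz, hΦ]
  simp [mul_comm]

/-- By Plancherel, integration by parts becomes the fact that `2πi⟨v,ξ⟩` is purely imaginary, so
conjugation produces the sign. -/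
theorem inner_toLp_lineDerivOp {v : E} {r y : Lp ℂ 2 (volume : Measure E)}
    (h : (𝓕 y : Lp ℂ 2 (volume : Measure E)) =ᵐ[volume]
      fun ξ => (2 * Real.pi * Complex.I) * (inner ℝ v ξ : ℂ) *
        (𝓕 r : Lp ℂ 2 (volume : Measure E)) ξ) (Θ : SchwartzMap E ℂ) :
    (inner ℂ ((LineDeriv.lineDerivOp v Θ : SchwartzMap E ℂ).toLp 2 volume) r : ℂ) =
      -inner ℂ (Θ.toLp 2 volume) y := by
  rw [← Lp.inner_fourier_eq, ← Lp.inner_fourier_eq (Θ.toLp 2 volume),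
    SchwartzMap.toLp_fourier_eq, SchwartzMap.toLp_fourier_eq, L2.inner_def, L2.inner_def,
    ← integral_neg]
  refine integral_congr_ae ?_
  filter_upwards [h, SchwartzMap.coeFn_toLp (𝓕 Θ) 2 volume, SchwartzMap.coeFn_toLp
    (𝓕 (LineDeriv.lineDerivOp v Θ : SchwartzMap E ℂ)) 2 volume] with ξ h1 h2 h3
  have h4 : (SchwartzMap.smulLeftCLM ℂ fun x => inner ℝ x v) (𝓕 Θ) ξ =
      (inner ℝ ξ v : ℝ) • (𝓕 Θ) ξ := SchwartzMap.smulLeftCLM_apply_apply (by fun_prop) _ _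
  have h5 : (𝓕 (LineDeriv.lineDerivOp v Θ : SchwartzMap E ℂ)) ξ =
      (2 * Real.pi * Complex.I) * ((inner ℝ v ξ : ℂ) * (𝓕 Θ) ξ) := by
    rw [SchwartzMap.fourier_lineDerivOp_eq, smul_apply, h4, real_inner_comm]
    rfl
  rw [h1, h2, h3, h5]
  simp only [RCLike.inner_apply, map_mul, Complex.conj_I, Complex.conj_ofReal, map_ofNat]
  ring

theorem contDiff_ofReal_comp {X : Type*} [NormedAddCommGroup X] [NormedSpace ℝ X] {θ : X → ℝ}
    (hθ : ContDiff ℝ ((⊤ : ℕ∞) : WithTop ℕ∞) θ) :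
    ContDiff ℝ ((⊤ : ℕ∞) : WithTop ℕ∞) (fun z => (θ z : ℂ)) := by
  have : ContDiff ℝ ((⊤ : ℕ∞) : WithTop ℕ∞) (Complex.ofRealCLM ∘ θ) :=
    Complex.ofRealCLM.contDiff.comp hθ
  exact this

theorem hasCompactSupport_ofReal_comp {X : Type*} [TopologicalSpace X] {θ : X → ℝ}
    (hθ : HasCompactSupport θ) :
    HasCompactSupport (fun z => (θ z : ℂ)) :=
  hθ.comp_left (g := fun x : ℝ => (x : ℂ)) Complex.ofReal_zero

theorem lineDerivOp_toSchwartzMap_ofReal {E : Type*} [NormedAddCommGroup E] [InnerProductSpace ℝ E]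
    {θ : E → ℝ}
    (hθ : ContDiff ℝ ((⊤ : ℕ∞) : WithTop ℕ∞) θ) (hθc : HasCompactSupport θ) (v z : E) :
    (LineDeriv.lineDerivOp v ((hasCompactSupport_ofReal_comp hθc).toSchwartzMap
      (contDiff_ofReal_comp hθ)) : SchwartzMap E ℂ) z = ((fderiv ℝ θ z v : ℝ) : ℂ) := by
  have h1 : HasFDerivAt (fun z => (θ z : ℂ)) (Complex.ofRealCLM.comp (fderiv ℝ θ z)) z :=
    Complex.ofRealCLM.hasFDerivAt.comp z ((hθ.differentiable (by simp)) z).hasFDerivAt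
  rw [SchwartzMap.lineDerivOp_apply_eq_fderiv]
  change fderiv ℝ (fun z => (θ z : ℂ)) z v = _
  rw [h1.fderiv]; rfl

/-- A square-integrable function is the weak derivative of another as soon as this holds on the
Fourier side. -/
theorem hasWeakDeriv_of_fourier {v : E} {r y : Lp ℂ 2 (volume : Measure E)}
    (h : (𝓕 y : Lp ℂ 2 (volume : Measure E)) =ᵐ[volume]
      fun ξ => (2 * Real.pi * Complex.I) * (inner ℝ v ξ : ℂ) *
        (𝓕 r : Lp ℂ 2 (volume : Measure E)) ξ) :
    HasWeakDeriv univ v r y := by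
  have hl : ∀ g : Lp ℂ 2 (volume : Measure E), LocallyIntegrableOn g univ volume := fun g =>
    locallyIntegrableOn_univ.2 ((Lp.memLp g).locallyIntegrable (by norm_num))
  refine ⟨hl r, hl y, fun θ hθ hθc _ => ?_⟩
  rw [setIntegral_univ, setIntegral_univ,
    integral_ofReal_mul_eq_inner (lineDerivOp_toSchwartzMap_ofReal hθ hθc v),
    integral_ofReal_mul_eq_inner (ρ := θ) (Φ := (hasCompactSupport_ofReal_comp hθc).toSchwartzMap
      (contDiff_ofReal_comp hθ)) (fun z => rfl), inner_toLp_lineDerivOp h]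
end FourierL2

/-! ### Lower bounds for the conjugated wave symbol. -/

section Symbol

/-- A small imaginary part forces the frequency `b` along `ω` to be close to `(z+1)τ/z`, which
exceeds `τ` in size; then `b² - τ²` is essentially nonnegative and the real part keeps the gain
`(z+1)² - z² = 2z + 1`. Here `z = 1/h`. -/
theorem le_norm_of_symbol {z τ b S : ℝ} (hz : 0 < z) (hS : b ^ 2 ≤ S) {D : ℂ}
    (hre : D.re = (z + 1) ^ 2 - τ ^ 2 - z ^ 2 + S) (him : D.im = 2 * z * b - 2 * (z + 1) * τ) :
    z ≤ ‖D‖ := by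
  by_contra! hlt
  have hX : D.re < z := (le_abs_self _).trans_lt ((Complex.abs_re_le_norm D).trans_lt hlt)
  have hY : |D.im| < z := (Complex.abs_im_le_norm D).trans_lt hlt
  obtain ⟨s, rfl⟩ : ∃ s, τ = z * s := ⟨τ / z, by field_simp⟩
  -- In the variables `s`, `δ` the imaginary part is `2zδ`, and the real part is at least
  -- `(2z+1)(1+s²) + 2(z+1)sδ + δ²`.
  obtain ⟨δ, rfl⟩ : ∃ δ, b = (z + 1) * s + δ := ⟨b - (z + 1) * s, by ring⟩
  have hδ : |δ| < 1 / 2 := by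
    have : D.im = 2 * z * δ := by rw [him]; ring
    rw [this, abs_mul, abs_of_pos (by positivity)] at hY
    nlinarith
  rw [abs_lt] at hδ
  rw [hre] at hX
  have h1 : 0 ≤ (1 + 2 * δ) * (s + 1) ^ 2 := by
    have : 0 ≤ 1 + 2 * δ := by linarith
    positivity
  have h2 : 0 ≤ (1 - 2 * δ) * (s - 1) ^ 2 := by
    have : 0 ≤ 1 - 2 * δ := by linarith
    positivity
  nlinarith [mul_nonneg hz.le h1, mul_nonneg hz.le h2, sq_nonneg s, sq_nonneg δ,
    mul_nonneg hz.le (sq_nonneg s)]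

/-- In the same variables the only term of indefinite sign in the real part is `2(z+1)sδ`, a
multiple of `s · Im D`. Absorbing it costs a factor `|s|`, which is the loss of one time derivative.
-/
theorem elliptic_bound_of_symbol {z τ b S : ℝ} (hz : 0 < z) (hS : b ^ 2 ≤ S) {D : ℂ}
    (hre : D.re = (z + 1) ^ 2 - τ ^ 2 - z ^ 2 + S) (him : D.im = 2 * z * b - 2 * (z + 1) * τ) :
    1 + τ ^ 2 + S ≤ (3 + z ^ 2 + 2 * (z + 1) ^ 2) * (1 + (z + 1) / z ^ 2) *
      (‖D‖ * (1 + |τ|)) := by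
  have hX : D.re ≤ ‖D‖ := (le_abs_self _).trans (Complex.abs_re_le_norm D)
  have hY : |D.im| ≤ ‖D‖ := Complex.abs_im_le_norm D
  set N := ‖D‖
  have hN : 0 ≤ N := norm_nonneg _
  obtain ⟨s, rfl⟩ : ∃ s, τ = z * s := ⟨τ / z, by field_simp⟩
  obtain ⟨δ, rfl⟩ : ∃ δ, b = (z + 1) * s + δ := ⟨b - (z + 1) * s, by ring⟩
  have him' : D.im = 2 * z * δ := by rw [him]; ring
  obtain ⟨c, rfl⟩ : ∃ c, S = ((z + 1) * s + δ) ^ 2 + c := ⟨S - ((z + 1) * s + δ) ^ 2, by ring⟩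
  have hc : 0 ≤ c := by linarith
  have h1 : -((z + 1) / z * |s| * N) ≤ 2 * ((z + 1) * s * δ) := by
    have e : 2 * ((z + 1) * s * δ) = (z + 1) / z * (s * D.im) := by rw [him']; field_simp
    have h2 : |s * D.im| ≤ |s| * N := by rw [abs_mul]; gcongr
    have h3 : 0 ≤ (z + 1) / z := by positivity
    rw [e]
    nlinarith [neg_abs_le (s * D.im), mul_le_mul_of_nonneg_left h2 h3,
      mul_le_mul_of_nonneg_left (neg_abs_le (s * D.im)) h3]
  have key : (1 + s ^ 2) + δ ^ 2 + c ≤ N * (1 + (z + 1) / z * |s|) := by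
    have : (2 * z + 1) * (1 + s ^ 2) + 2 * ((z + 1) * s * δ) + δ ^ 2 + c = D.re := by rw [hre]; ring
    nlinarith [sq_nonneg s, mul_nonneg hz.le (sq_nonneg s)]
  have key2 : N * (1 + (z + 1) / z * |s|) ≤ (1 + (z + 1) / z ^ 2) * (N * (1 + |z * s|)) := by
    have e : (z + 1) / z * |s| = (z + 1) / z ^ 2 * |z * s| := by
      rw [abs_mul, abs_of_pos hz]; field_simp
    rw [e]
    have h3 : 0 ≤ (z + 1) / z ^ 2 := by positivity
    nlinarith [mul_nonneg hN h3, mul_nonneg hN (abs_nonneg (z * s))]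
  have key3 : 1 + (z * s) ^ 2 + (((z + 1) * s + δ) ^ 2 + c) ≤
      (3 + z ^ 2 + 2 * (z + 1) ^ 2) * ((1 + s ^ 2) + δ ^ 2 + c) := by
    have e : ((z + 1) * s + δ) ^ 2 ≤ 2 * ((z + 1) * s) ^ 2 + 2 * δ ^ 2 := by
      nlinarith [sq_nonneg ((z + 1) * s - δ)]
    have p1 : 0 ≤ z ^ 2 * (δ ^ 2 + c + 1) := by positivity
    have p2 : 0 ≤ 2 * (z + 1) ^ 2 * (δ ^ 2 + c + 1) := by positivity
    nlinarith [sq_nonneg s, sq_nonneg δ]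
  calc _ ≤ _ := key3
    _ ≤ (3 + z ^ 2 + 2 * (z + 1) ^ 2) * ((1 + (z + 1) / z ^ 2) * (N * (1 + |z * s|))) := by
      gcongr
      exact key.trans key2
    _ = _ := by ring

variable {n : ℕ}

/-- Space-time with its Euclidean norm. -/
abbrev EuclideanSpaceTime (n : ℕ) : Type := WithLp 2 (ℝ × EuclideanSpace ℝ (Fin n))

/-- The symbol of `e^{φ/h + t} □ e^{-φ/h - t}`. -/
noncomputable def waveSymbol (h : ℝ) (ω : EuclideanSpace ℝ (Fin n)) (ξ : EuclideanSpaceTime n) : ℂ :=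
  (2 * Real.pi * Complex.I * (ξ.fst : ℂ) - ((h⁻¹ + 1 : ℝ) : ℂ)) ^ 2 -
    ∑ k, (2 * Real.pi * Complex.I * (ξ.snd k : ℂ) - ((ω k * h⁻¹ : ℝ) : ℂ)) ^ 2

theorem continuous_waveSymbol (h : ℝ) (ω : EuclideanSpace ℝ (Fin n)) :
    Continuous (waveSymbol h ω) := by
  unfold waveSymbol
  have h1 : Continuous fun ξ : EuclideanSpaceTime n => ξ.fst := by fun_prop
  have h2 : ∀ k, Continuous fun ξ : EuclideanSpaceTime n => ξ.snd k := fun k => by fun_prop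
  fun_prop

theorem waveSymbol_re_im (h : ℝ) {ω : EuclideanSpace ℝ (Fin n)} (hω : ‖ω‖ = 1)
    (ξ : EuclideanSpaceTime n) :
    (waveSymbol h ω ξ).re = (h⁻¹ + 1) ^ 2 - (2 * Real.pi * ξ.fst) ^ 2 - (h⁻¹) ^ 2 +
      (2 * Real.pi) ^ 2 * ‖ξ.snd‖ ^ 2 ∧
    (waveSymbol h ω ξ).im = 2 * h⁻¹ * (2 * Real.pi * inner ℝ ω ξ.snd) -
      2 * (h⁻¹ + 1) * (2 * Real.pi * ξ.fst) := by
  have hω2 : ∑ k, ω k ^ 2 = 1 := by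
    have := EuclideanSpace.real_norm_sq_eq ω
    rw [hω] at this; simpa using this.symm
  constructor
  · rw [waveSymbol, EuclideanSpace.real_norm_sq_eq, Complex.sub_re, Complex.re_sum]
    have : ∀ k, ((2 * Real.pi * Complex.I * (ξ.snd k : ℂ) - ((ω k * h⁻¹ : ℝ) : ℂ)) ^ 2).re =
        ω k ^ 2 * (h⁻¹) ^ 2 - (2 * Real.pi) ^ 2 * (ξ.snd k) ^ 2 := fun k => by
      simp [pow_two]; ring
    simp_rw [this]
    rw [Finset.sum_sub_distrib, ← Finset.sum_mul, hω2, ← Finset.mul_sum]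
    simp [pow_two]; ring
  · rw [waveSymbol, Complex.sub_im, Complex.im_sum]
    have : ∀ k, ((2 * Real.pi * Complex.I * (ξ.snd k : ℂ) - ((ω k * h⁻¹ : ℝ) : ℂ)) ^ 2).im =
        -(2 * h⁻¹ * (2 * Real.pi)) * (ω k * ξ.snd k) := fun k => by
      simp [pow_two]; ring
    simp_rw [this]
    have hi : inner ℝ ω ξ.snd = ∑ k, ω k * ξ.snd k := by
      rw [PiLp.inner_apply]; simp [mul_comm]
    rw [← Finset.mul_sum, hi]
    simp [pow_two]; ring

theorem inner_sq_le_of_norm_one {ω : EuclideanSpace ℝ (Fin n)} (hω : ‖ω‖ = 1)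
    (x : EuclideanSpace ℝ (Fin n)) :
    (2 * Real.pi * inner ℝ ω x) ^ 2 ≤ (2 * Real.pi) ^ 2 * ‖x‖ ^ 2 := by
  rw [mul_pow]
  have := abs_real_inner_le_norm ω x
  rw [hω, one_mul] at this
  exact mul_le_mul_of_nonneg_left (sq_le_sq' (abs_le.1 this).1 (abs_le.1 this).2) (by positivity)

theorem inv_le_norm_waveSymbol {h : ℝ} (hh : 0 < h) {ω : EuclideanSpace ℝ (Fin n)} (hω : ‖ω‖ = 1)
    (ξ : EuclideanSpaceTime n) : h⁻¹ ≤ ‖waveSymbol h ω ξ‖ :=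
  le_norm_of_symbol (inv_pos.2 hh) (inner_sq_le_of_norm_one hω ξ.snd)
    (waveSymbol_re_im h hω ξ).1 (waveSymbol_re_im h hω ξ).2

theorem exists_elliptic_bound_waveSymbol {h : ℝ} (hh : 0 < h) {ω : EuclideanSpace ℝ (Fin n)}
    (hω : ‖ω‖ = 1) :
    ∃ K : ℝ, ∀ ξ : EuclideanSpaceTime n, 1 + ‖ξ‖ ^ 2 ≤
      K * (‖waveSymbol h ω ξ‖ * (1 + |ξ.fst|)) := by
  have hz := inv_pos.2 hh
  set z := h⁻¹
  refine ⟨(3 + z ^ 2 + 2 * (z + 1) ^ 2) * (1 + (z + 1) / z ^ 2) * (2 * Real.pi), fun ξ => ?_⟩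
  have h1 := elliptic_bound_of_symbol hz (inner_sq_le_of_norm_one hω ξ.snd)
    (waveSymbol_re_im h hω ξ).1 (waveSymbol_re_im h hω ξ).2
  have hp : 1 ≤ 2 * Real.pi := by linarith [Real.pi_gt_three]
  have h2 : 1 + ‖ξ‖ ^ 2 ≤ 1 + (2 * Real.pi * ξ.fst) ^ 2 + (2 * Real.pi) ^ 2 * ‖ξ.snd‖ ^ 2 := by
    rw [WithLp.prod_norm_sq_eq_of_L2, Real.norm_eq_abs, sq_abs]
    have : 1 ≤ (2 * Real.pi) ^ 2 := one_le_pow₀ hp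
    nlinarith [sq_nonneg ξ.fst, sq_nonneg ‖ξ.snd‖]
  have h3 : 1 + |2 * Real.pi * ξ.fst| ≤ 2 * Real.pi * (1 + |ξ.fst|) := by
    rw [abs_mul, abs_of_pos (by positivity : 0 < 2 * Real.pi)]; linarith
  calc _ ≤ _ := h2
    _ ≤ _ := h1
    _ ≤ (3 + z ^ 2 + 2 * (z + 1) ^ 2) * (1 + (z + 1) / z ^ 2) *
        (‖waveSymbol h ω ξ‖ * (2 * Real.pi * (1 + |ξ.fst|))) := by gcongr
    _ = _ := by ring

end Symbol

/-! ### An abstract contraction and its regularity under a commuting operator. -/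

section FixedPoint

variable {H ι : Type*} [NormedAddCommGroup H] [NormedSpace ℂ H] [Fintype ι]

theorem norm_sum_apply_le {A : ι → ι → H →L[ℂ] H} {M : ℝ} (hA : ∀ i j, ‖A i j‖ ≤ M)
    (u : ι → H) (i : ι) : ‖∑ j, A i j (u j)‖ ≤ Fintype.card ι * M * ‖u‖ := by
  calc ‖∑ j, A i j (u j)‖ ≤ ∑ j, ‖A i j (u j)‖ := norm_sum_le _ _
    _ ≤ ∑ _j : ι, M * ‖u‖ := by
      refine Finset.sum_le_sum fun j _ => (ContinuousLinearMap.le_opNorm _ _).trans ?_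
      have hM : 0 ≤ M := (norm_nonneg _).trans (hA i j)
      exact mul_le_mul (hA i j) (norm_le_pi_norm u j) (norm_nonneg _) hM
    _ = Fintype.card ι * M * ‖u‖ := by simp [mul_assoc]

/-- The map is a contraction with constant `1/2` for the sup norm over components, and `‖r‖ ≤ ‖f‖ +
‖r‖/2` gives the factor `2`. -/
theorem exists_system_fixedPoint [CompleteSpace H] {G : H →L[ℂ] H} (hG : ‖G‖ ≤ 1)
    {A : ι → ι → H →L[ℂ] H} {M : ℝ} (hA : ∀ i j, ‖A i j‖ ≤ M) (f : ι → H) {ε : ℝ} (hε : 0 ≤ ε)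
    (hεM : ε * (Fintype.card ι * M) ≤ 1 / 2) :
    ∃ r : ι → H, (∀ i, r i = G (f i - (ε : ℂ) • ∑ j, A i j (r j))) ∧ ‖r‖ ≤ 2 * ‖f‖ := by
  have hG' : ∀ x, ‖G x‖ ≤ ‖x‖ := fun x => by
    simpa using (G.le_opNorm x).trans (mul_le_mul_of_nonneg_right hG (norm_nonneg x))
  have hb : ∀ (u : ι → H) i, ‖(ε : ℂ) • ∑ j, A i j (u j)‖ ≤ 1 / 2 * ‖u‖ := fun u i => by
    rw [norm_smul, Complex.norm_real, Real.norm_of_nonneg hε]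
    calc ε * ‖∑ j, A i j (u j)‖ ≤ ε * (Fintype.card ι * M * ‖u‖) := by
          gcongr; exact norm_sum_apply_le hA u i
      _ = ε * (Fintype.card ι * M) * ‖u‖ := by ring
      _ ≤ _ := by gcongr
  let Φ : (ι → H) → ι → H := fun u i => G (f i - (ε : ℂ) • ∑ j, A i j (u j))
  have hΦ : ContractingWith (1 / 2) Φ := by
    refine ⟨by norm_num, LipschitzWith.of_dist_le_mul fun u w => ?_⟩
    rw [dist_eq_norm, dist_eq_norm]
    refine (pi_norm_le_iff_of_nonneg (by positivity)).2 fun i => ?_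
    have : (Φ u - Φ w) i = -G ((ε : ℂ) • ∑ j, A i j ((u - w) j)) := by
      simp only [Φ, Pi.sub_apply, map_sub, Finset.sum_sub_distrib, smul_sub]
      abel
    rw [this, norm_neg]
    refine (hG' _).trans ((hb (u - w) i).trans ?_)
    simp
  refine ⟨hΦ.fixedPoint, fun i => (congrFun hΦ.fixedPoint_isFixedPt i).symm, ?_⟩
  set r := hΦ.fixedPoint
  have : ‖r‖ ≤ ‖f‖ + 1 / 2 * ‖r‖ := by
    refine (pi_norm_le_iff_of_nonneg (by positivity)).2 fun i => ?_
    have e : r i = G (f i - (ε : ℂ) • ∑ j, A i j (r j)) :=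
      (congrFun hΦ.fixedPoint_isFixedPt i).symm
    rw [e]
    exact (hG' _).trans ((norm_sub_le _ _).trans (add_le_add (norm_le_pi_norm f i) (hb r i)))
  linarith

/-- With `T` the translation by `s`, this is an `O(s)` bound on `TF - F` that assumes no regularity
of `r`: since `G` commutes with `T`, the increment of `r` is `G` of that of `F`, and the
zeroth-order coupling returns at most half of it. -/
theorem norm_system_commutator_le {G T : H →L[ℂ] H} (hG : ‖G‖ ≤ 1)
    (hGT : ∀ x, T (G x) = G (T x)) {A : ι → ι → H →L[ℂ] H} {M L s C : ℝ} (hC : 0 ≤ C)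
    (hL : 0 ≤ L) (hs : 0 ≤ s)
    (hA : ∀ i j, ‖A i j‖ ≤ M) (hAT : ∀ i j x, ‖T (A i j x) - A i j (T x)‖ ≤ L * s * ‖x‖)
    {f r F : ι → H} (hf : ∀ i, ‖T (f i) - f i‖ ≤ C * s) {ε : ℝ} (hε : 0 ≤ ε)
    (hεM : ε * (Fintype.card ι * M) ≤ 1 / 2) (hr : ∀ i, r i = G (F i))
    (hF : ∀ i, F i = f i - (ε : ℂ) • ∑ j, A i j (r j)) (i : ι) :
    ‖T (F i) - F i‖ ≤ 2 * (C + ε * (Fintype.card ι * L * ‖r‖)) * s := by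
  let d : ι → H := fun i => T (F i) - F i
  let e : ι → H := fun i => T (r i) - r i
  have hed : ‖e‖ ≤ ‖d‖ := by
    refine (pi_norm_le_iff_of_nonneg (norm_nonneg _)).2 fun i => ?_
    have : e i = G (d i) := by simp only [e, d, hr i, hGT, map_sub]
    rw [this]
    calc _ ≤ ‖G‖ * ‖d i‖ := G.le_opNorm _
      _ ≤ 1 * ‖d‖ := by gcongr; exact norm_le_pi_norm d i
      _ = _ := one_mul _
  have hd : ‖d‖ ≤ (C + ε * (Fintype.card ι * L * ‖r‖)) * s + 1 / 2 * ‖d‖ := by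
    refine (pi_norm_le_iff_of_nonneg (by positivity)).2 fun i => ?_
    -- The increment splits into that of the source, the commutator of `T` with the coefficients,
    -- and the coefficients applied to the increment of `r`; the last part is absorbed on the left.
    have : d i = (T (f i) - f i) - (ε : ℂ) • (∑ j, (T (A i j (r j)) - A i j (T (r j)))) -
        (ε : ℂ) • ∑ j, A i j (e j) := by
      simp only [d, e, hF i, map_sub, map_smul, map_sum, Finset.sum_sub_distrib, smul_sub]
      abel
    rw [this]
    have h1 : ‖(ε : ℂ) • ∑ j, A i j (e j)‖ ≤ 1 / 2 * ‖d‖ := by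
      rw [norm_smul, Complex.norm_real, Real.norm_of_nonneg hε]
      calc ε * ‖∑ j, A i j (e j)‖ ≤ ε * (Fintype.card ι * M * ‖e‖) := by
            gcongr; exact norm_sum_apply_le hA e i
        _ = ε * (Fintype.card ι * M) * ‖e‖ := by ring
        _ ≤ _ := by gcongr
    have h2 : ‖(ε : ℂ) • (∑ j, (T (A i j (r j)) - A i j (T (r j))))‖ ≤
        ε * (Fintype.card ι * L * ‖r‖) * s := by
      rw [norm_smul, Complex.norm_real, Real.norm_of_nonneg hε, mul_assoc]
      gcongr
      calc _ ≤ ∑ j, ‖T (A i j (r j)) - A i j (T (r j))‖ := norm_sum_le _ _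
        _ ≤ ∑ _j : ι, L * s * ‖r‖ := by
          refine Finset.sum_le_sum fun j _ => (hAT i j (r j)).trans ?_
          gcongr; exact norm_le_pi_norm r j
        _ = Fintype.card ι * L * ‖r‖ * s := by simp; ring
    calc _ ≤ ‖T (f i) - f i‖ + ‖(ε : ℂ) • (∑ j, (T (A i j (r j)) - A i j (T (r j))))‖ +
          ‖(ε : ℂ) • ∑ j, A i j (e j)‖ :=
          (norm_sub_le _ _).trans (add_le_add_left (norm_sub_le _ _) _)
      _ ≤ C * s + ε * (Fintype.card ι * L * ‖r‖) * s + 1 / 2 * ‖d‖ := by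
        gcongr; exact hf i
      _ = _ := by ring
  have := norm_le_pi_norm d i
  change ‖d i‖ ≤ _
  linarith

end FixedPoint

/-! ### Systems of Fourier multiplier equations on `L²`. -/

section MultiplierSystem

open scoped FourierTransform

variable {E : Type*} [NormedAddCommGroup E] [InnerProductSpace ℝ E] [FiniteDimensional ℝ E]
  [MeasurableSpace E] [BorelSpace E]

/-- The Fourier multiplier with a bounded symbol, on `L²`. -/
theorem exists_lpFourierMultiplier {m : E → ℂ} (hm : AEStronglyMeasurable m volume)
    (hm1 : ∀ ξ, ‖m ξ‖ ≤ 1) :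
    ∃ G : Lp ℂ 2 (volume : Measure E) →L[ℂ] Lp ℂ 2 (volume : Measure E), ‖G‖ ≤ 1 ∧
      (∀ f : Lp ℂ 2 (volume : Measure E), (𝓕 (G f) : Lp ℂ 2 (volume : Measure E)) =ᵐ[volume]
        fun ξ => m ξ * (𝓕 f : Lp ℂ 2 (volume : Measure E)) ξ) ∧
      ∀ a f, lpTranslate a (G f) = G (lpTranslate a f) := by
  obtain ⟨S, hS, hSe⟩ := exists_lpMul m 1 zero_le_one hm (ae_of_all _ hm1)
  let U : Lp ℂ 2 (volume : Measure E) ≃ₗᵢ[ℂ] Lp ℂ 2 (volume : Measure E) :=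
    Lp.fourierTransformₗᵢ E ℂ
  let G : Lp ℂ 2 (volume : Measure E) →L[ℂ] Lp ℂ 2 (volume : Measure E) :=
    U.symm.toContinuousLinearEquiv.toContinuousLinearMap ∘L S ∘L
      U.toContinuousLinearEquiv.toContinuousLinearMap
  have hG : ∀ f, G f = U.symm (S (U f)) := fun f => rfl
  have hUG : ∀ f, U (G f) = S (U f) := fun f => by rw [hG, U.apply_symm_apply]
  refine ⟨G, ?_, fun f => ?_, fun a f => ?_⟩
  · refine ContinuousLinearMap.opNorm_le_bound _ zero_le_one fun f => ?_
    rw [hG, LinearIsometryEquiv.norm_map]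
    calc _ ≤ ‖S‖ * ‖U f‖ := S.le_opNorm _
      _ ≤ 1 * ‖f‖ := by rw [U.norm_map]; gcongr
  · change (U (G f) : E → ℂ) =ᵐ[volume] _
    rw [hUG]
    exact hSe _
  · apply U.injective
    rw [hUG]
    apply Lp.ext
    have h1 : (U (lpTranslate a (G f)) : E → ℂ) =ᵐ[volume] _ := fourier_lpTranslate a (G f)
    have h2 : (U (lpTranslate a f) : E → ℂ) =ᵐ[volume] _ := fourier_lpTranslate a f
    have h3 : (𝓕 (G f) : Lp ℂ 2 (volume : Measure E)) = S (U f) := hUG f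
    filter_upwards [h1, h2, hSe (U f), hSe (U (lpTranslate a f))] with ξ a1 a2 a3 a4
    rw [a1, a4, a2, h3, a3]
    change _ = m ξ * (_ * (U f : E → ℂ) ξ)
    ring

/-- Applies the contraction with `G` the multiplier by `m`. The commutator of a translation with
multiplication by `a i j` is multiplication by an increment of `a i j`, hence `O(s)`; the regularity
of each `F i` in the direction `e` follows. -/
theorem exists_multiplier_system {ι : Type*} [Fintype ι] {e : E} {m : E → ℂ}
    (hm : AEStronglyMeasurable m volume) (hm1 : ∀ ξ, ‖m ξ‖ ≤ 1) {a : ι → ι → E → ℂ} {M L C : ℝ}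
    (hM : 0 ≤ M) (hL : 0 ≤ L) (hC : 0 ≤ C)
    (ham : ∀ i j, AEStronglyMeasurable (a i j) volume) (haM : ∀ i j x, ‖a i j x‖ ≤ M)
    (haL : ∀ i j x (s : ℝ), 0 ≤ s → ‖a i j (x + s • e) - a i j x‖ ≤ L * s)
    {f : ι → Lp ℂ 2 (volume : Measure E)}
    (hf : ∀ i (s : ℝ), 0 < s → s ≤ 1 → ‖lpTranslate (s • e) (f i) - f i‖ ≤ C * s)
    {ε : ℝ} (hε : 0 ≤ ε) (hεM : ε * (Fintype.card ι * M) ≤ 1 / 2) :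
    ∃ r F : ι → Lp ℂ 2 (volume : Measure E),
      (∀ i, F i =ᵐ[volume] fun x => f i x - (ε : ℂ) * ∑ j, a i j x * r j x) ∧
      (∀ i, (𝓕 (r i) : Lp ℂ 2 (volume : Measure E)) =ᵐ[volume]
        fun ξ => m ξ * (𝓕 (F i) : Lp ℂ 2 (volume : Measure E)) ξ) ∧
      ‖r‖ ≤ 2 * ‖f‖ ∧
      ∀ i, MemLp (fun ξ => (inner ℝ e ξ : ℂ) * (𝓕 (F i) : Lp ℂ 2 (volume : Measure E)) ξ) 2
        volume := by
  obtain ⟨G, hG, hGe, hGT⟩ := exists_lpFourierMultiplier hm hm1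
  choose A hA hAe using fun i j => exists_lpMul (μ := (volume : Measure E)) (a i j) M hM (ham i j)
    (ae_of_all _ (haM i j))
  obtain ⟨r, hr, hrn⟩ := exists_system_fixedPoint hG hA f hε hεM
  let F : ι → Lp ℂ 2 (volume : Measure E) := fun i => f i - (ε : ℂ) • ∑ j, A i j (r j)
  refine ⟨r, F, fun i => ?_, fun i => ?_, hrn, fun i => ?_⟩
  · have hall : ∀ᵐ x ∂(volume : Measure E), ∀ j, A i j (r j) x = a i j x * r j x :=
      ae_all_iff.2 fun j => hAe i j (r j)
    filter_upwards [hall, Lp.coeFn_sub (f i) ((ε : ℂ) • ∑ j, A i j (r j)),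
      Lp.coeFn_smul (ε : ℂ) (∑ j, A i j (r j)),
      Lp.coeFn_fun_finsetSum Finset.univ fun j => A i j (r j)] with x h1 h2 h3 h4
    simp only [F]
    rw [h2, Pi.sub_apply, h3, Pi.smul_apply, h4, smul_eq_mul]
    simp only [h1]
  · rw [hr i]
    exact hGe _
  · refine memLp_inner_mul_fourier_of_lpTranslate_le
      (C := 2 * (C + ε * (Fintype.card ι * L * ‖r‖))) fun s hs hs1 => ?_
    refine norm_system_commutator_le (T := (lpTranslate (s • e)).toContinuousLinearMap) (G := G)
      (A := A) (f := f) hG (fun x => hGT _ x) hC hL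
      hs.le hA ?_ (fun i => hf i s hs hs1) hε hεM hr (fun i => rfl) i
    intro i j u
    refine (Lp.norm_le_mul_norm_of_ae_le_mul (c := L * s)
      (g := lpTranslate (s • e) u) ?_).trans_eq ?_
    · have h0 := (quasiMeasurePreserving_add_right (volume : Measure E) (s • e)).ae (hAe i j u)
      filter_upwards [Lp.coeFn_sub (lpTranslate (s • e) (A i j u)) (A i j (lpTranslate (s • e) u)),
        coeFn_lpTranslate (s • e) (A i j u), coeFn_lpTranslate (s • e) u,
        hAe i j (lpTranslate (s • e) u), h0] with x h1 h2 h3 h4 h5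
      change ‖(lpTranslate (s • e) (A i j u) - A i j (lpTranslate (s • e) u) : Lp ℂ 2 _) x‖ ≤ _
      rw [h1, Pi.sub_apply, h2, h4, h3, h5, ← sub_mul, norm_mul]
      gcongr
      exact haL i j x s hs.le
    · rw [LinearIsometry.norm_map]

end MultiplierSystem

/-! ### Calculus of weak derivatives. -/

section WeakDerivatives

variable {E : Type*} [NormedAddCommGroup E] [NormedSpace ℝ E] [MeasureSpace E] {U : Set E} {v : E}
  {f g f₁ g₁ : E → ℂ}

theorem integrableOn_mul_of_hasCompactSupport {E : Type*} [NormedAddCommGroup E] [MeasureSpace E]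
    {U : Set E} {f : E → ℂ} [OpensMeasurableSpace E]
    (hf : LocallyIntegrableOn f U volume) {Θ : E → ℂ} (hΘ : Continuous Θ)
    (hc : HasCompactSupport Θ) (hs : tsupport Θ ⊆ U) :
    IntegrableOn (fun z => Θ z * f z) U volume := by
  have hK : IsCompact (tsupport Θ) := hc
  have h1 : IntegrableOn f (tsupport Θ) volume := hf.integrableOn_compact_subset hs hK
  obtain ⟨C, hC⟩ := hc.exists_bound_of_continuous hΘ
  have h2 : IntegrableOn (fun z => Θ z * f z) (tsupport Θ) volume :=
    Integrable.bdd_mul (c := C) h1 hΘ.aestronglyMeasurable.restrict (ae_of_all _ hC)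
  have h3 : Integrable (fun z => Θ z * f z) volume := by
    refine (integrableOn_iff_integrable_of_support_subset fun z hz => ?_).1 h2
    exact subset_tsupport Θ (left_ne_zero_of_mul hz)
  exact h3.integrableOn

theorem tsupport_subset_of_zero {X α β : Type*} [TopologicalSpace X] [Zero α] [Zero β] {f : X → α}
    {g : X → β} (h : ∀ z, f z = 0 → g z = 0) : tsupport g ⊆ tsupport f :=
  closure_mono fun z hz h0 => hz (h z h0)

/-- Real and imaginary parts of a complex test function are real test functions. Complex ones occur
when a real test function is multiplied by a complex exponential. -/
theorem HasWeakDeriv.integral_fderiv_mul [OpensMeasurableSpace E] (h : HasWeakDeriv U v f g)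
    {Θ : E → ℂ}
    (hΘ : ContDiff ℝ ((⊤ : ℕ∞) : WithTop ℕ∞) Θ) (hc : HasCompactSupport Θ) (hs : tsupport Θ ⊆ U) :
    ∫ z in U, fderiv ℝ Θ z v * f z = -∫ z in U, Θ z * g z := by
  have key : ∀ L : ℂ →L[ℝ] ℝ,
      ∫ z in U, ((L (fderiv ℝ Θ z v) : ℝ) : ℂ) * f z = -∫ z in U, (L (Θ z) : ℂ) * g z := fun L => by
    have h1 := h.2.2 (fun z => L (Θ z)) (L.contDiff.comp hΘ) (hc.comp_left (map_zero L))
      ((tsupport_subset_of_zero fun z h0 => by simp [h0]).trans hs)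
    have h2 : ∀ z, fderiv ℝ (fun z => L (Θ z)) z v = L (fderiv ℝ Θ z v) := fun z => by
      have := L.hasFDerivAt.comp z (hΘ.differentiable (by simp) z).hasFDerivAt
      have e : fderiv ℝ (fun z => L (Θ z)) z = L.comp (fderiv ℝ Θ z) := this.fderiv
      rw [e]; rfl
    simpa only [h2] using h1
  have hsplit : ∀ {Ψ φ : E → ℂ}, Continuous Ψ → HasCompactSupport Ψ → tsupport Ψ ⊆ U →
      LocallyIntegrableOn φ U volume → ∫ z in U, Ψ z * φ z =
        (∫ z in U, ((Complex.reCLM (Ψ z) : ℝ) : ℂ) * φ z) +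
          Complex.I * ∫ z in U, ((Complex.imCLM (Ψ z) : ℝ) : ℂ) * φ z := by
    intro Ψ φ h1 h2 h3 h4
    have hi : ∀ L : ℂ →L[ℝ] ℝ, Integrable (fun z => ((L (Ψ z) : ℝ) : ℂ) * φ z)
        (volume.restrict U) := fun L =>
      integrableOn_mul_of_hasCompactSupport h4 (Complex.continuous_ofReal.comp (L.continuous.comp h1))
        (h2.comp_left (g := fun z => ((L z : ℝ) : ℂ)) (by simp))
        ((tsupport_subset_of_zero fun z h0 => by simp [h0]).trans h3)
    rw [← integral_const_mul, ← integral_add (hi _) ((hi _).const_mul _)]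
    refine integral_congr_ae (ae_of_all _ fun z => ?_)
    simp only [Complex.reCLM_apply, Complex.imCLM_apply]
    nth_rewrite 1 [← Complex.re_add_im (Ψ z)]
    ring
  have hd : Continuous fun z => fderiv ℝ Θ z v :=
    (hΘ.continuous_fderiv (by simp)).clm_apply continuous_const
  rw [hsplit hd (hc.fderiv_apply ℝ v)
    ((tsupport_fderiv_apply_subset ℝ v).trans hs) h.1, hsplit hΘ.continuous hc hs h.2.1,
    key Complex.reCLM, key Complex.imCLM]
  ring

theorem HasWeakDeriv.add [OpensMeasurableSpace E] (h : HasWeakDeriv U v f g)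
    (h₁ : HasWeakDeriv U v f₁ g₁) :
    HasWeakDeriv U v (fun z => f z + f₁ z) (fun z => g z + g₁ z) := by
  refine ⟨h.1.add h₁.1, h.2.1.add h₁.2.1, fun θ hθ hc hs => ?_⟩
  have hs' : tsupport (fun z => (θ z : ℂ)) ⊆ U :=
    (tsupport_subset_of_zero fun z h0 => by simp [h0]).trans hs
  have hi : ∀ {φ : E → ℂ}, LocallyIntegrableOn φ U volume →
      Integrable (fun z => (θ z : ℂ) * φ z) (volume.restrict U) := fun hφ =>
    integrableOn_mul_of_hasCompactSupport hφ (contDiff_ofReal_comp hθ).continuous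
      (hasCompactSupport_ofReal_comp hc) hs'
  have hd : Continuous fun z => fderiv ℝ θ z v :=
    (hθ.continuous_fderiv (by simp)).clm_apply continuous_const
  have hi' : ∀ {φ : E → ℂ}, LocallyIntegrableOn φ U volume →
      Integrable (fun z => ((fderiv ℝ θ z v : ℝ) : ℂ) * φ z) (volume.restrict U) := fun hφ =>
    integrableOn_mul_of_hasCompactSupport hφ (Complex.continuous_ofReal.comp hd)
      (hasCompactSupport_ofReal_comp (hc.fderiv_apply ℝ v))
      ((tsupport_subset_of_zero fun z h0 => by simp [h0]).trans
        ((tsupport_fderiv_apply_subset ℝ v).trans hs))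
  simp only [mul_add]
  rw [integral_add (hi' h.1) (hi' h₁.1), integral_add (hi h.2.1) (hi h₁.2.1), h.2.2 θ hθ hc hs,
    h₁.2.2 θ hθ hc hs]
  ring

theorem HasWeakDeriv.const_mul (h : HasWeakDeriv U v f g) (c : ℂ) :
    HasWeakDeriv U v (fun z => c * f z) (fun z => c * g z) := by
  refine ⟨h.1.smul c, h.2.1.smul c, fun θ hθ hc hs => ?_⟩
  simp only [mul_left_comm _ c, integral_const_mul]
  rw [h.2.2 θ hθ hc hs, mul_neg]

theorem HasWeakDeriv.restrict (h : HasWeakDeriv univ v f g) (U : Set E) : HasWeakDeriv U v f g := by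
  refine ⟨h.1.mono_set (subset_univ U), h.2.1.mono_set (subset_univ U), fun θ hθ hc hs => ?_⟩
  have := h.2.2 θ hθ hc (subset_univ _)
  rw [setIntegral_univ, setIntegral_univ] at this
  rw [setIntegral_eq_integral_of_forall_compl_eq_zero,
    setIntegral_eq_integral_of_forall_compl_eq_zero, this]
  · intro z hz
    rw [image_eq_zero_of_notMem_tsupport fun h => hz (hs h)]; simp
  · intro z hz
    have : z ∉ tsupport (fun z => fderiv ℝ θ z v) := fun h =>
      hz (hs (tsupport_fderiv_apply_subset ℝ v h))
    rw [image_eq_zero_of_notMem_tsupport this]; simp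

/-- The Leibniz rule, obtained by moving the smooth exponential from the function to the test
function. -/
theorem HasWeakDeriv.exp_mul [OpensMeasurableSpace E] [SecondCountableTopology E]
    [LocallyCompactSpace E] (hU : IsOpen U)
    (h : HasWeakDeriv U v f g) (l : E →L[ℝ] ℂ) :
    HasWeakDeriv U v (fun z => Complex.exp (l z) * f z)
      (fun z => Complex.exp (l z) * (g z + l v * f z)) := by
  have hexp : ContDiff ℝ ((⊤ : ℕ∞) : WithTop ℕ∞) fun z => Complex.exp (l z) :=
    Complex.contDiff_exp.comp l.contDiff
  have hm : ∀ {φ : E → ℂ}, LocallyIntegrableOn φ U volume →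
      LocallyIntegrableOn (fun z => Complex.exp (l z) * φ z) U volume := fun hφ =>
    hφ.continuousOn_mul hexp.continuous.continuousOn hU.isLocallyClosed
  refine ⟨hm h.1, hm (h.2.1.add (h.1.smul (l v))), fun θ hθ hc hs => ?_⟩
  let Θ : E → ℂ := fun z => Complex.exp (l z) * (θ z : ℂ)
  have hΘ : ContDiff ℝ ((⊤ : ℕ∞) : WithTop ℕ∞) Θ := hexp.mul (contDiff_ofReal_comp hθ)
  have hΘc : HasCompactSupport Θ := (hasCompactSupport_ofReal_comp hc).mul_left
  have hΘs : tsupport Θ ⊆ U := (tsupport_subset_of_zero fun z h0 => by simp [Θ, h0]).trans hs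
  have hΘd : ∀ z, fderiv ℝ Θ z v =
      Complex.exp (l z) * ((fderiv ℝ θ z v : ℝ) : ℂ) + l v * Θ z := fun z => by
    have h1 : HasFDerivAt (fun z => (θ z : ℂ)) (Complex.ofRealCLM.comp (fderiv ℝ θ z)) z :=
      Complex.ofRealCLM.hasFDerivAt.comp z ((hθ.differentiable (by simp)) z).hasFDerivAt
    have h2 := (l.hasFDerivAt (x := z)).cexp
    have h3 : fderiv ℝ Θ z = _ := (h2.mul h1).fderiv
    rw [h3]
    simp [Θ]
    ring
  have hmain := h.integral_fderiv_mul hΘ hΘc hΘs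
  have hi1 : Integrable (fun z => fderiv ℝ Θ z v * f z) (volume.restrict U) :=
    integrableOn_mul_of_hasCompactSupport h.1
      ((hΘ.continuous_fderiv (by simp)).clm_apply continuous_const)
      (hΘc.fderiv_apply ℝ v) ((tsupport_fderiv_apply_subset ℝ v).trans hΘs)
  have hi2 : Integrable (fun z => Θ z * f z) (volume.restrict U) :=
    integrableOn_mul_of_hasCompactSupport h.1 hΘ.continuous hΘc hΘs
  have hi3 : Integrable (fun z => Θ z * g z) (volume.restrict U) :=
    integrableOn_mul_of_hasCompactSupport h.2.1 hΘ.continuous hΘc hΘs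
  calc ∫ z in U, ((fderiv ℝ θ z v : ℝ) : ℂ) * (Complex.exp (l z) * f z)
      = ∫ z in U, (fderiv ℝ Θ z v * f z - l v * (Θ z * f z)) := by
        refine integral_congr_ae (ae_of_all _ fun z => ?_)
        simp only [hΘd]
        ring
    _ = -((∫ z in U, Θ z * g z) + ∫ z in U, l v * (Θ z * f z)) := by
        rw [integral_sub hi1 (hi2.const_mul _), hmain]
        ring
    _ = -∫ z in U, (θ z : ℂ) * (Complex.exp (l z) * (g z + l v * f z)) := by
        rw [← integral_add hi3 (hi2.const_mul _)]
        congr 1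
        refine integral_congr_ae (ae_of_all _ fun z => ?_)
        simp only [Θ]
        ring

theorem hasWeakDeriv_const [BorelSpace E] [FiniteDimensional ℝ E]
    [(volume : Measure E).IsAddHaarMeasure] (U : Set E) (v : E) (c : ℂ) :
    HasWeakDeriv U v (fun _ => c) (fun _ => 0) := by
  refine HasWeakDeriv.restrict ⟨locallyIntegrableOn_univ.2 (locallyIntegrable_const c),
    locallyIntegrableOn_univ.2 (locallyIntegrable_const 0), fun θ hθ hc _ => ?_⟩ U
  have hd : Continuous fun z => fderiv ℝ θ z v :=
    (hθ.continuous_fderiv (by simp)).clm_apply continuous_const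
  have h0 : ∫ z, fderiv ℝ θ z v = 0 := by
    have := integral_mul_fderiv_eq_neg_fderiv_mul_of_integrable (𝕜 := ℝ) (μ := (volume : Measure E))
      (f := fun _ : E => (1 : ℝ)) (g := θ) (v := v) (by simp) (by
        simpa using hd.integrable_of_hasCompactSupport (hc.fderiv_apply ℝ v))
      (by simpa using hθ.continuous.integrable_of_hasCompactSupport hc)
      (fun z _ => differentiableAt_const _) (fun z _ => hθ.differentiable (by simp) z)
    simpa using this
  simp only [setIntegral_univ, mul_zero, integral_zero, neg_zero]
  rw [integral_mul_const, integral_complex_ofReal, h0]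
  simp

end WeakDerivatives

/-! ### Stability of Sobolev spaces under sums and exponential factors. -/

section Sobolev

variable {E : Type*} [NormedAddCommGroup E] [NormedSpace ℝ E] [MeasureSpace E] {U : Set E}
  {p : ℝ≥0∞} {f g : E → ℂ}

theorem MemSobolevOn.memLp {k : ℕ} (h : MemSobolevOn U p k f) : MemLp f p (volume.restrict U) := by
  cases k with
  | zero => exact h
  | succ k => exact h.1

theorem MemSobolevOn.add [OpensMeasurableSpace E] {k : ℕ} (hf : MemSobolevOn U p k f)
    (hg : MemSobolevOn U p k g) : MemSobolevOn U p k (fun z => f z + g z) := by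
  induction k generalizing f g with
  | zero => exact MemLp.add hf hg
  | succ k ih =>
    refine ⟨MemLp.add hf.1 hg.1, fun v => ?_⟩
    obtain ⟨f', hf', hfk⟩ := hf.2 v
    obtain ⟨g', hg', hgk⟩ := hg.2 v
    exact ⟨_, hf'.add hg', ih hfk hgk⟩

theorem MemSobolevOn.const_mul {k : ℕ} (hf : MemSobolevOn U p k f) (c : ℂ) :
    MemSobolevOn U p k (fun z => c * f z) := by
  induction k generalizing f with
  | zero => exact MemLp.const_mul hf c
  | succ k ih =>
    refine ⟨MemLp.const_mul hf.1 c, fun v => ?_⟩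
    obtain ⟨f', hf', hfk⟩ := hf.2 v
    exact ⟨_, hf'.const_mul c, ih hfk⟩

theorem memLp_exp_mul [OpensMeasurableSpace E] (hUb : Bornology.IsBounded U) (hU : MeasurableSet U)
    (hf : MemLp f p (volume.restrict U)) (l : E →L[ℝ] ℂ) :
    MemLp (fun z => Complex.exp (l z) * f z) p (volume.restrict U) := by
  obtain ⟨R, hR⟩ := hUb.exists_norm_le
  have hc : Continuous fun z => Complex.exp (l z) := Complex.continuous_exp.comp l.continuous
  refine MemLp.of_le_mul (c := Real.exp (‖l‖ * R)) hf
    (hc.aestronglyMeasurable.mul hf.1) ?_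
  filter_upwards [ae_restrict_mem hU] with z hz
  rw [norm_mul]
  gcongr
  rw [Complex.norm_exp]
  gcongr
  exact (Complex.re_le_norm _).trans ((l.le_opNorm z).trans (by gcongr; exact hR z hz))

theorem MemSobolevOn.exp_mul [OpensMeasurableSpace E] [SecondCountableTopology E]
    [LocallyCompactSpace E] (hU : IsOpen U) (hUb : Bornology.IsBounded U) (l : E →L[ℝ] ℂ)
    {k : ℕ} (hf : MemSobolevOn U p k f) : MemSobolevOn U p k (fun z => Complex.exp (l z) * f z) := by
  induction k generalizing f with
  | zero => exact memLp_exp_mul hUb hU.measurableSet hf l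
  | succ k ih =>
    refine ⟨memLp_exp_mul hUb hU.measurableSet hf.1 l, fun v => ?_⟩
    obtain ⟨f', hf', hfk⟩ := hf.2 v
    refine ⟨_, hf'.exp_mul hU l, ?_⟩
    -- The Leibniz rule produces the term `l v * f`, so the induction hypothesis is also needed for
    -- `f` at the lower order `k`.
    have h1 : MemSobolevOn U p k f := by
      clear hf' hfk ih f'
      induction k generalizing f with
      | zero => exact hf.1
      | succ k ih =>
        refine ⟨hf.1, fun v => ?_⟩
        obtain ⟨f', hf', hfk⟩ := hf.2 v
        exact ⟨f', hf', ih hfk⟩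
    exact ih (hfk.add (h1.const_mul (l v)))

theorem memSobolevOn_const [BorelSpace E] [FiniteDimensional ℝ E]
    [(volume : Measure E).IsAddHaarMeasure] (hUb : Bornology.IsBounded U) (k : ℕ) (c : ℂ) :
    MemSobolevOn U p k (fun _ => c) := by
  have : IsFiniteMeasure (volume.restrict U) :=
    ⟨by rw [Measure.restrict_apply_univ]; exact hUb.measure_lt_top⟩
  induction k generalizing c with
  | zero => exact memLp_const c
  | succ k ih => exact ⟨memLp_const c, fun v => ⟨_, hasWeakDeriv_const U v c, ih 0⟩⟩

end Sobolev

/-! ### Passage between the product norm and the Euclidean norm on space-time. -/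

section SpaceTimeTransfer

open scoped FourierTransform

variable {n : ℕ}

instance SpaceTime.isAddHaarMeasure_volume :
    (volume : Measure (SpaceTime n)).IsAddHaarMeasure := by
  change ((volume : Measure ℝ).prod (volume : Measure (EuclideanSpace ℝ (Fin n)))).IsAddHaarMeasure
  infer_instance

theorem EuclideanSpaceTime.measurePreserving_toLp :
    MeasurePreserving (WithLp.toLp 2 : SpaceTime n → EuclideanSpaceTime n) volume volume :=
  WithLp.volume_preserving_toLp ℝ (EuclideanSpace ℝ (Fin n))

/-- The Fourier transform lives on the Euclidean model and the cylinder on the product. The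
identification is linear, bicontinuous and measure preserving, so test functions and integrals carry
over. -/
theorem HasWeakDeriv.comp_toLp {v : EuclideanSpaceTime n} {f g : EuclideanSpaceTime n → ℂ}
    (h : HasWeakDeriv univ v f g) :
    HasWeakDeriv univ (WithLp.ofLp v) (fun z => f (WithLp.toLp 2 z))
      (fun z => g (WithLp.toLp 2 z)) := by
  let e : EuclideanSpaceTime n ≃L[ℝ] SpaceTime n :=
    WithLp.prodContinuousLinearEquiv 2 ℝ ℝ (EuclideanSpace ℝ (Fin n))
  have hmp := EuclideanSpaceTime.measurePreserving_toLp (n := n)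
  have hme : MeasurableEmbedding (WithLp.toLp 2 : SpaceTime n → EuclideanSpaceTime n) :=
    e.symm.toHomeomorph.measurableEmbedding
  have hloc : ∀ {φ : EuclideanSpaceTime n → ℂ}, LocallyIntegrableOn φ univ volume →
      LocallyIntegrableOn (fun z : SpaceTime n => φ (WithLp.toLp 2 z)) univ volume := by
    intro φ hφ
    rw [locallyIntegrableOn_univ] at hφ ⊢
    refine locallyIntegrable_iff.2 fun K hK => ?_
    have h1 : IsCompact (e ⁻¹' K) := by
      rw [← e.image_symm_eq_preimage]; exact hK.image e.symm.continuous
    have h2 := (hmp.integrableOn_comp_preimage hme (f := φ) (s := e ⁻¹' K)).2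
      (hφ.integrableOn_isCompact h1)
    exact h2
  refine ⟨hloc h.1, hloc h.2.1, fun θ hθ hc _ => ?_⟩
  have h1 := h.2.2 (fun z => θ (e z)) (hθ.comp e.contDiff)
    (hc.comp_homeomorph e.toHomeomorph) (subset_univ _)
  simp only [setIntegral_univ] at h1 ⊢
  rw [← hmp.integral_comp hme, ← hmp.integral_comp hme] at h1
  have h2 : ∀ z : SpaceTime n, fderiv ℝ (fun z => θ (e z)) (WithLp.toLp 2 z) v =
      fderiv ℝ θ z (WithLp.ofLp v) := fun z => by
    have h3 : HasFDerivAt (fun z => θ (e z))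
        ((fderiv ℝ θ (e (WithLp.toLp 2 z))).comp (e : EuclideanSpaceTime n →L[ℝ] SpaceTime n))
        (WithLp.toLp 2 z) :=
      (hθ.differentiable (by simp) _).hasFDerivAt.comp _ e.hasFDerivAt
    rw [h3.fderiv]; rfl
  simp only [h2] at h1
  exact h1

theorem memLp_comp_toLp (f : Lp ℂ 2 (volume : Measure (EuclideanSpaceTime n))) :
    MemLp (fun z : SpaceTime n => f (WithLp.toLp 2 z)) 2 volume :=
  (Lp.memLp f).comp_measurePreserving EuclideanSpaceTime.measurePreserving_toLp

end SpaceTimeTransfer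

/-! ### Two weak derivatives from decay of the Fourier transform. -/

section FourierDerivatives

open scoped FourierTransform

variable {E : Type*} [NormedAddCommGroup E] [InnerProductSpace ℝ E] [FiniteDimensional ℝ E]
  [MeasurableSpace E] [BorelSpace E]

theorem exists_lp_fourier_eq {φ : E → ℂ} (hφ : MemLp φ 2 (volume : Measure E)) :
    ∃ y : Lp ℂ 2 (volume : Measure E), (𝓕 y : Lp ℂ 2 (volume : Measure E)) =ᵐ[volume] φ := by
  refine ⟨(Lp.fourierTransformₗᵢ E ℂ).symm hφ.toLp, ?_⟩
  have : 𝓕 ((Lp.fourierTransformₗᵢ E ℂ).symm hφ.toLp) = hφ.toLp :=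
    (Lp.fourierTransformₗᵢ E ℂ).apply_symm_apply _
  rw [this]
  exact hφ.coeFn_toLp

theorem exists_lp_weakDeriv {r : Lp ℂ 2 (volume : Measure E)}
    (h : MemLp (fun ξ => ((1 + ‖ξ‖ ^ 2 : ℝ) : ℂ) * (𝓕 r : Lp ℂ 2 (volume : Measure E)) ξ) 2
      volume) :
    ∃ (d : E → Lp ℂ 2 (volume : Measure E)) (dd : E → E → Lp ℂ 2 (volume : Measure E)),
      (∀ v, HasWeakDeriv univ v r (d v)) ∧ (∀ v w, HasWeakDeriv univ w (d v) (dd v w)) ∧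
      (∀ v, (𝓕 (d v) : Lp ℂ 2 (volume : Measure E)) =ᵐ[volume]
        fun ξ => (2 * Real.pi * Complex.I) * (inner ℝ v ξ : ℂ) *
          (𝓕 r : Lp ℂ 2 (volume : Measure E)) ξ) ∧
      (∀ v w, (𝓕 (dd v w) : Lp ℂ 2 (volume : Measure E)) =ᵐ[volume]
        fun ξ => (2 * Real.pi * Complex.I) * (inner ℝ w ξ : ℂ) *
          ((2 * Real.pi * Complex.I) * (inner ℝ v ξ : ℂ) *
            (𝓕 r : Lp ℂ 2 (volume : Measure E)) ξ)) := by
  have hr := Lp.aestronglyMeasurable (𝓕 r : Lp ℂ 2 (volume : Measure E))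
  have hc : ∀ v : E, Continuous fun ξ : E => (2 * Real.pi * Complex.I) * (inner ℝ v ξ : ℂ) :=
    fun v => by fun_prop
  have hn : ∀ v ξ : E, ‖(2 * Real.pi * Complex.I) * (inner ℝ v ξ : ℂ)‖ ≤ 2 * Real.pi * ‖v‖ * ‖ξ‖ :=
    fun v ξ => by
      have : ‖(2 * Real.pi * Complex.I : ℂ)‖ = 2 * Real.pi := by
        simp [abs_of_pos Real.pi_pos]
      rw [norm_mul, this, Complex.norm_real, mul_assoc (2 * Real.pi)]
      exact mul_le_mul_of_nonneg_left (norm_inner_le_norm v ξ) (by positivity)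
  have hξ : ∀ ξ : E, ‖((1 + ‖ξ‖ ^ 2 : ℝ) : ℂ)‖ = 1 + ‖ξ‖ ^ 2 := fun ξ => by
    rw [Complex.norm_real, Real.norm_of_nonneg (by positivity)]
  have h1 : ∀ v : E, MemLp (fun ξ => (2 * Real.pi * Complex.I) * (inner ℝ v ξ : ℂ) *
      (𝓕 r : Lp ℂ 2 (volume : Measure E)) ξ) 2 volume := fun v => by
    refine MemLp.of_le_mul (c := 2 * Real.pi * ‖v‖) h ((hc v).aestronglyMeasurable.mul hr)
      (ae_of_all _ fun ξ => ?_)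
    rw [norm_mul, norm_mul (((1 + ‖ξ‖ ^ 2 : ℝ) : ℂ)), hξ, ← mul_assoc]
    gcongr
    refine (hn v ξ).trans ?_
    gcongr
    nlinarith [sq_nonneg (‖ξ‖ - 1)]
  have h2 : ∀ v w : E, MemLp (fun ξ => (2 * Real.pi * Complex.I) * (inner ℝ w ξ : ℂ) *
      ((2 * Real.pi * Complex.I) * (inner ℝ v ξ : ℂ) *
        (𝓕 r : Lp ℂ 2 (volume : Measure E)) ξ)) 2 volume := fun v w => by
    refine MemLp.of_le_mul (c := 2 * Real.pi * ‖w‖ * (2 * Real.pi * ‖v‖)) h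
      ((hc w).aestronglyMeasurable.mul ((hc v).aestronglyMeasurable.mul hr))
      (ae_of_all _ fun ξ => ?_)
    rw [norm_mul, norm_mul ((2 * Real.pi * Complex.I) * (inner ℝ v ξ : ℂ)),
      norm_mul (((1 + ‖ξ‖ ^ 2 : ℝ) : ℂ)), hξ, ← mul_assoc, ← mul_assoc]
    refine mul_le_mul_of_nonneg_right ?_ (norm_nonneg _)
    calc _ ≤ (2 * Real.pi * ‖w‖ * ‖ξ‖) * (2 * Real.pi * ‖v‖ * ‖ξ‖) :=
          mul_le_mul (hn w ξ) (hn v ξ) (norm_nonneg _) (by positivity)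
      _ = 2 * Real.pi * ‖w‖ * (2 * Real.pi * ‖v‖) * ‖ξ‖ ^ 2 := by ring
      _ ≤ _ := mul_le_mul_of_nonneg_left (by linarith) (by positivity)
  choose d hd using fun v => exists_lp_fourier_eq (h1 v)
  choose dd hdd using fun v w => exists_lp_fourier_eq (h2 v w)
  refine ⟨d, dd, fun v => hasWeakDeriv_of_fourier (hd v),
    fun v w => hasWeakDeriv_of_fourier ?_, hd, hdd⟩
  filter_upwards [hd v, hdd v w] with ξ a b
  rw [b, a]

end FourierDerivatives

/-! ### The weak wave operator and its conjugation by exponentials. -/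

section Box

variable {n : ℕ} {U : Set (SpaceTime n)}

theorem HasWeakSecondDeriv.add {E : Type*} [NormedAddCommGroup E] [NormedSpace ℝ E] [MeasureSpace E]
    [OpensMeasurableSpace E] {U : Set E} {v : E} {f g f₁ g₁ : E → ℂ}
    (h : HasWeakSecondDeriv U v f g) (h₁ : HasWeakSecondDeriv U v f₁ g₁) :
    HasWeakSecondDeriv U v (fun z => f z + f₁ z) (fun z => g z + g₁ z) := by
  obtain ⟨f', a, b⟩ := h
  obtain ⟨f₁', a₁, b₁⟩ := h₁
  exact ⟨_, a.add a₁, b.add b₁⟩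

theorem HasWeakSecondDeriv.const_mul {E : Type*} [NormedAddCommGroup E] [NormedSpace ℝ E]
    [MeasureSpace E] {U : Set E} {v : E} {f g : E → ℂ} (h : HasWeakSecondDeriv U v f g) (c : ℂ) :
    HasWeakSecondDeriv U v (fun z => c * f z) (fun z => c * g z) := by
  obtain ⟨f', a, b⟩ := h
  exact ⟨_, a.const_mul c, b.const_mul c⟩

theorem HasWeakBox.add {u w u₁ w₁ : SpaceTime n → ℂ} (h : HasWeakBox U u w)
    (h₁ : HasWeakBox U u₁ w₁) : HasWeakBox U (fun z => u z + u₁ z) (fun z => w z + w₁ z) := by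
  obtain ⟨a, b, ha, hb, hw⟩ := h
  obtain ⟨a₁, b₁, ha₁, hb₁, hw₁⟩ := h₁
  refine ⟨_, fun k z => b k z + b₁ k z, ha.add ha₁, fun k => (hb k).add (hb₁ k), ?_⟩
  filter_upwards [hw, hw₁] with z h1 h2
  rw [h1, h2, Finset.sum_add_distrib]; ring

theorem HasWeakBox.const_mul {u w : SpaceTime n → ℂ} (h : HasWeakBox U u w) (c : ℂ) :
    HasWeakBox U (fun z => c * u z) (fun z => c * w z) := by
  obtain ⟨a, b, ha, hb, hw⟩ := h
  refine ⟨_, fun k z => c * b k z, ha.const_mul c, fun k => (hb k).const_mul c, ?_⟩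
  filter_upwards [hw] with z h1
  rw [h1, ← Finset.mul_sum]; ring

theorem HasWeakDeriv.exp_mul_second {E : Type*} [NormedAddCommGroup E] [NormedSpace ℝ E]
    [MeasureSpace E] [OpensMeasurableSpace E] [SecondCountableTopology E]
    [LocallyCompactSpace E] {U : Set E} (hU : IsOpen U) {v : E} {f f' f'' : E → ℂ}
    (h : HasWeakDeriv U v f f') (h' : HasWeakDeriv U v f' f'') (l : E →L[ℝ] ℂ) :
    HasWeakSecondDeriv U v (fun z => Complex.exp (l z) * f z)
      (fun z => Complex.exp (l z) * ((f'' z + l v * f' z) + l v * (f' z + l v * f z))) :=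
  ⟨_, h.exp_mul hU l, (h'.add (h.const_mul (l v))).exp_mul hU l⟩

/-- The operator `□` conjugated by an exponential. -/
theorem hasWeakBox_exp_mul (hU : IsOpen U) {f f₀ f₀₀ : SpaceTime n → ℂ}
    {f₁ f₁₁ : Fin n → SpaceTime n → ℂ}
    (h0 : HasWeakDeriv U ((1 : ℝ), (0 : EuclideanSpace ℝ (Fin n))) f f₀)
    (h00 : HasWeakDeriv U ((1 : ℝ), (0 : EuclideanSpace ℝ (Fin n))) f₀ f₀₀)
    (h1 : ∀ k, HasWeakDeriv U ((0 : ℝ), EuclideanSpace.single k (1 : ℝ)) f (f₁ k))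
    (h11 : ∀ k, HasWeakDeriv U ((0 : ℝ), EuclideanSpace.single k (1 : ℝ)) (f₁ k) (f₁₁ k))
    (l : SpaceTime n →L[ℝ] ℂ) {c : ℂ} {b : Fin n → ℂ} (hc : l ((1 : ℝ), 0) = c)
    (hb : ∀ k, l ((0 : ℝ), EuclideanSpace.single k (1 : ℝ)) = b k) :
    HasWeakBox U (fun z => Complex.exp (l z) * f z) (fun z => Complex.exp (l z) *
      ((f₀₀ z + 2 * c * f₀ z + c ^ 2 * f z) -
        ∑ k, (f₁₁ k z + 2 * b k * f₁ k z + b k ^ 2 * f z))) := by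
  refine ⟨_, _, h0.exp_mul_second hU h00 l, fun k => (h1 k).exp_mul_second hU (h11 k) l,
    ae_of_all _ fun z => ?_⟩
  simp only [hc, hb]
  rw [mul_sub, Finset.mul_sum]
  congr 1
  · ring
  · exact Finset.sum_congr rfl fun k _ => by ring

theorem hasWeakBox_exp (hU : IsOpen U) (l : SpaceTime n →L[ℝ] ℂ) {c : ℂ} {b : Fin n → ℂ}
    (hc : l ((1 : ℝ), 0) = c) (hb : ∀ k, l ((0 : ℝ), EuclideanSpace.single k (1 : ℝ)) = b k) :
    HasWeakBox U (fun z => Complex.exp (l z))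
      (fun z => Complex.exp (l z) * (c ^ 2 - ∑ k, b k ^ 2)) := by
  have := hasWeakBox_exp_mul hU (hasWeakDeriv_const U ((1 : ℝ), (0 : EuclideanSpace ℝ (Fin n))) 1)
    (hasWeakDeriv_const U ((1 : ℝ), (0 : EuclideanSpace ℝ (Fin n))) 0)
    (fun k => hasWeakDeriv_const U ((0 : ℝ), EuclideanSpace.single k (1 : ℝ)) 1)
    (fun k => hasWeakDeriv_const U ((0 : ℝ), EuclideanSpace.single k (1 : ℝ)) 0) l hc hb
  simpa using this

end Box

/-! ### Mollification and stability of upper limits. -/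

section Mollification

open Filter Topology
open scoped Convolution

variable {E : Type*} [NormedAddCommGroup E] [NormedSpace ℝ E] [FiniteDimensional ℝ E]
  [MeasureSpace E] [BorelSpace E] [(volume : Measure E).IsAddHaarMeasure] {U : Set E} {f g : E → ℂ}

/-- Mollification of the extension by zero of a function on `U`. -/
noncomputable def mollify (φ : ContDiffBump (0 : E)) (U : Set E) (f : E → ℂ) : E → ℂ :=
  (U.indicator f) ⋆[(ContinuousLinearMap.lsmul ℝ ℝ).flip, volume] (φ.normed volume)

theorem mollify_apply {E : Type*} [NormedAddCommGroup E] [NormedSpace ℝ E]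
    [FiniteDimensional ℝ E] [MeasureSpace E] {U : Set E}
    (φ : ContDiffBump (0 : E)) (hU : MeasurableSet U) (f : E → ℂ) (x : E) :
    mollify φ U f x = ∫ y in U, (φ.normed volume (x - y) : ℂ) * f y := by
  rw [← integral_indicator hU]
  refine integral_congr_ae (ae_of_all _ fun y => ?_)
  by_cases hy : y ∈ U <;> simp [hy]

theorem integral_normed_sub (φ : ContDiffBump (0 : E)) (x : E) :
    ∫ y, φ.normed volume (x - y) = 1 := by
  rw [integral_sub_left_eq_self]
  exact φ.integral_normed

theorem norm_integral_normed_mul_le (φ : ContDiffBump (0 : E)) {M : ℝ} (hM : 0 ≤ M)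
    (hf : ∀ᵐ z ∂(volume.restrict U), ‖f z‖ ≤ M) (x : E) :
    ‖∫ y in U, (φ.normed volume (x - y) : ℂ) * f y‖ ≤ M := by
  have hi : Integrable (fun y => M * φ.normed volume (x - y)) volume :=
    (φ.integrable_normed.comp_sub_left x).const_mul M
  calc _ ≤ ∫ y in U, M * φ.normed volume (x - y) := by
        refine norm_integral_le_of_norm_le hi.integrableOn ?_
        filter_upwards [hf] with y hy
        rw [norm_mul, Complex.norm_real, Real.norm_of_nonneg (φ.nonneg_normed _), mul_comm]
        exact mul_le_mul_of_nonneg_right hy (φ.nonneg_normed _)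
    _ ≤ ∫ y, M * φ.normed volume (x - y) :=
        setIntegral_le_integral hi (ae_of_all _ fun y => mul_nonneg hM (φ.nonneg_normed _))
    _ = M := by rw [integral_const_mul, integral_normed_sub, mul_one]

theorem locallyIntegrable_indicator {E : Type*} [NormedAddCommGroup E] [MeasureSpace E]
    [IsLocallyFiniteMeasure (volume : Measure E)] {U : Set E} {f : E → ℂ} (hU : MeasurableSet U)
    (hf : MemLp f ∞ (volume.restrict U)) : LocallyIntegrable (U.indicator f) volume :=
  ((memLp_indicator_iff_restrict hU).2 hf).locallyIntegrable le_top

theorem continuous_mollify (φ : ContDiffBump (0 : E)) (hU : MeasurableSet U)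
    (hf : MemLp f ∞ (volume.restrict U)) : Continuous (mollify φ U f) :=
  φ.hasCompactSupport_normed.continuous_convolution_right _ (locallyIntegrable_indicator hU hf)
    φ.continuous_normed

/-- When the ball lies in `U`, the reflected and translated mollifier is an admissible test
function. The derivative of the mollification is then the mollification of `g`, an average bounded
by `L`; the cut at the boundary of `U` is not seen. -/
theorem mollify_fderiv_bound {v : E} (φ : ContDiffBump (0 : E)) (hU : MeasurableSet U)
    (hf : MemLp f ∞ (volume.restrict U)) (h : HasWeakDeriv U v f g) {L : ℝ} (hL : 0 ≤ L)
    (hg : ∀ᵐ z ∂(volume.restrict U), ‖g z‖ ≤ L) {x : E} (hx : Metric.closedBall x φ.rOut ⊆ U) :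
    DifferentiableAt ℝ (mollify φ U f) x ∧ ‖fderiv ℝ (mollify φ U f) x v‖ ≤ L := by
  have hsm : ContDiff ℝ ((⊤ : ℕ∞) : WithTop ℕ∞) (φ.normed (volume : Measure E)) :=
    φ.contDiff_normed
  have hd : HasFDerivAt (mollify φ U f) _ x :=
    φ.hasCompactSupport_normed.hasFDerivAt_convolution_right
      ((ContinuousLinearMap.lsmul ℝ ℝ).flip : ℂ →L[ℝ] ℝ →L[ℝ] ℂ)
      (locallyIntegrable_indicator hU hf) (hsm.of_le (by simp)) x
  refine ⟨hd.differentiableAt, ?_⟩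
  rw [hd.fderiv]
  have e1 := convolution_precompR_apply (L := ((ContinuousLinearMap.lsmul ℝ ℝ).flip :
    ℂ →L[ℝ] ℝ →L[ℝ] ℂ)) (locallyIntegrable_indicator hU hf)
    (φ.hasCompactSupport_normed.fderiv (𝕜 := ℝ)) (hsm.continuous_fderiv (by simp)) x v
  rw [e1]
  let θ : E → ℝ := fun y => φ.normed volume (x - y)
  have hθ : ContDiff ℝ ((⊤ : ℕ∞) : WithTop ℕ∞) θ := hsm.comp (contDiff_const.sub contDiff_id)
  have hθs : tsupport θ ⊆ Metric.closedBall x φ.rOut := by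
    refine closure_minimal (fun y hy => ?_) Metric.isClosed_closedBall
    have : x - y ∈ Function.support (φ.normed (volume : Measure E)) := hy
    rw [φ.support_normed_eq, mem_ball_zero_iff] at this
    rw [Metric.mem_closedBall, dist_comm, dist_eq_norm]
    exact this.le
  have hθc : HasCompactSupport θ :=
    (isCompact_closedBall x φ.rOut).of_isClosed_subset (isClosed_tsupport θ) hθs
  have hθd : ∀ y, fderiv ℝ θ y v = -fderiv ℝ (φ.normed (volume : Measure E)) (x - y) v := fun y => by
    have h1 : HasFDerivAt θ ((fderiv ℝ (φ.normed (volume : Measure E)) (x - y)).comp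
        (-ContinuousLinearMap.id ℝ E)) y :=
      (hsm.differentiable (by simp) _).hasFDerivAt.comp y
        ((hasFDerivAt_id y).const_sub x)
    rw [h1.fderiv]; simp
  have h2 := h.2.2 θ hθ hθc (hθs.trans hx)
  have e2 : ((U.indicator f) ⋆[((ContinuousLinearMap.lsmul ℝ ℝ).flip : ℂ →L[ℝ] ℝ →L[ℝ] ℂ), volume]
      fun a => fderiv ℝ (φ.normed (volume : Measure E)) a v) x = ∫ y in U, (θ y : ℂ) * g y := by
    rw [← neg_inj, ← h2, ← integral_indicator hU, convolution_def, ← integral_neg]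
    refine integral_congr_ae (ae_of_all _ fun y => ?_)
    by_cases hy : y ∈ U <;> simp [hy, hθd]
  rw [e2]
  exact norm_integral_normed_mul_le φ hL hg x

theorem abs_limsup_sub_le {u w : ℕ → ℝ} {M d : ℝ} (hu : ∀ k, |u k| ≤ M) (hw : ∀ k, |w k| ≤ M)
    (h : ∀ᶠ k in atTop, |u k - w k| ≤ d) : |limsup u atTop - limsup w atTop| ≤ d := by
  have key : ∀ {u w : ℕ → ℝ}, (∀ k, |u k| ≤ M) → (∀ k, |w k| ≤ M) →
      (∀ᶠ k in atTop, |u k - w k| ≤ d) → limsup u atTop ≤ limsup w atTop + d := by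
    intro u w hu hw h
    have hb : ∀ {w : ℕ → ℝ}, (∀ k, |w k| ≤ M) → IsBoundedUnder (· ≤ ·) atTop w := fun hw =>
      isBoundedUnder_of ⟨M, fun k => (abs_le.1 (hw k)).2⟩
    have hb' : ∀ {w : ℕ → ℝ}, (∀ k, |w k| ≤ M) → IsBoundedUnder (· ≥ ·) atTop w := fun hw =>
      isBoundedUnder_of ⟨-M, fun k => (abs_le.1 (hw k)).1⟩
    rw [← limsup_add_const atTop w d (hb hw) (hb' hw).isCoboundedUnder_le]
    refine limsup_le_limsup ?_ (hb' hu).isCoboundedUnder_le ?_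
    · filter_upwards [h] with k hk
      linarith [(abs_le.1 hk).2]
    · exact isBoundedUnder_of ⟨M + d, fun k => by linarith [(abs_le.1 (hw k)).2]⟩
  have h' : ∀ᶠ k in atTop, |w k - u k| ≤ d := h.mono fun k hk => by rwa [abs_sub_comm]
  rw [abs_le]
  constructor
  · linarith [key hw hu h']
  · linarith [key hu hw h]

theorem abs_limsup_le {u : ℕ → ℝ} {M : ℝ} (hu : ∀ k, |u k| ≤ M) : |limsup u atTop| ≤ M := by
  have hM : 0 ≤ M := (abs_nonneg _).trans (hu 0)
  simpa using abs_limsup_sub_le (w := fun _ => 0) hu (fun _ => by simpa using hM)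
    (Eventually.of_forall fun k => by simpa using hu k)

end Mollification

/-! ### Extension of the coefficients, Lipschitz in time. -/

section TimeExtension

open Filter Topology

variable {n : ℕ} {Ω : Set (EuclideanSpace ℝ (Fin n))} {T : ℝ}

theorem isOpen_spaceTimeCylinder (hΩ : IsOpen Ω) : IsOpen (spaceTimeCylinder T Ω) :=
  isOpen_Ioo.prod hΩ

theorem isBounded_spaceTimeCylinder (hΩ : Bornology.IsBounded Ω) :
    Bornology.IsBounded (spaceTimeCylinder T Ω) :=
  (Metric.isBounded_Ioo 0 T).prod hΩ

theorem closedBall_subset_spaceTimeCylinder {r t : ℝ} {x : EuclideanSpace ℝ (Fin n)} (hr : 0 < r)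
    (hx : Metric.closedBall x r ⊆ Ω) (ht : 2 * r ≤ t) (ht' : t ≤ T - 2 * r) :
    Metric.closedBall (t, x) r ⊆ spaceTimeCylinder T Ω := by
  rw [← closedBall_prod_same, Real.closedBall_eq_Icc]
  exact prod_mono (fun s hs => ⟨by linarith [hs.1], by linarith [hs.2]⟩) hx

/-- A bounded function on a cylinder with a bounded weak time derivative agrees almost everywhere
with a function which is bounded on the whole space-time and Lipschitz in time there. -/
theorem exists_timeLipschitz_extension (hΩ : IsOpen Ω) (hT : 0 < T) {f : SpaceTime n → ℂ}
    (hf : MemSobolevOn (spaceTimeCylinder T Ω) ∞ 1 f) :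
    ∃ (a : SpaceTime n → ℂ) (M L : ℝ), 0 ≤ M ∧ 0 ≤ L ∧ Measurable a ∧ (∀ z, ‖a z‖ ≤ M) ∧
      (∀ t s x, 0 ≤ s → ‖a (t + s, x) - a (t, x)‖ ≤ L * s) ∧
      ∀ᵐ z ∂(volume.restrict (spaceTimeCylinder T Ω)), a z = f z := by
  set Q := spaceTimeCylinder T Ω
  have hQ : IsOpen Q := isOpen_spaceTimeCylinder hΩ
  obtain ⟨hf0, hf1⟩ := hf
  obtain ⟨g, hg, hgL⟩ := hf1 ((1 : ℝ), (0 : EuclideanSpace ℝ (Fin n)))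
  have hgL : MemLp g ∞ (volume.restrict Q) := hgL
  have hbound : ∀ {φ : SpaceTime n → ℂ}, MemLp φ ∞ (volume.restrict Q) →
      ∃ M : ℝ, 0 ≤ M ∧ ∀ᵐ z ∂(volume.restrict Q), ‖φ z‖ ≤ M := fun {φ} hφ =>
    ⟨(eLpNorm φ ∞ (volume.restrict Q)).toReal, ENNReal.toReal_nonneg, by
      filter_upwards [ae_le_eLpNormEssSup (f := φ) (μ := volume.restrict Q)] with z hz
      have := ENNReal.toReal_mono hφ.eLpNorm_ne_top (by simpa [eLpNorm_exponent_top] using hz)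
      simpa using this⟩
  obtain ⟨M, hM0, hM⟩ := hbound hf0
  obtain ⟨L, hL0, hL⟩ := hbound hgL
  let r : ℕ → ℝ := fun k => 1 / ((k : ℝ) + 1)
  have hr0 : ∀ k, 0 < r k := fun k => by positivity
  have hrlim : Tendsto r atTop (𝓝 0) := tendsto_one_div_add_atTop_nhds_zero_nat
  -- Keeping the ratio of the outer to the inner radius equal to `2` gives almost everywhere
  -- convergence of the mollifications.
  let φ : ℕ → ContDiffBump (0 : SpaceTime n) := fun k =>
    ⟨r k / 2, r k, half_pos (hr0 k), half_lt_self (hr0 k)⟩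
  let F : ℕ → SpaceTime n → ℂ := fun k => mollify (φ k) Q f
  -- Clamping time to `[2r, T - 2r]` keeps the mollification ball inside the time interval. It is
  -- `1`-Lipschitz and eventually the identity at each `t` in `(0, T)`.
  let c : ℕ → ℝ → ℝ := fun k t => max (2 * r k) (min t (T - 2 * r k))
  have hF : ∀ k z, ‖F k z‖ ≤ M := fun k z => by
    simp only [F]
    rw [mollify_apply _ hQ.measurableSet]
    exact norm_integral_normed_mul_le _ hM0 hM z
  have hFc : ∀ k, Continuous (F k) := fun k => continuous_mollify _ hQ.measurableSet hf0
  have hc : ∀ k, Continuous (c k) := fun k => by fun_prop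
  have hcl : ∀ k t s, |c k t - c k s| ≤ |t - s| := fun k t s => by
    have h1 := abs_max_sub_max_le_max (2 * r k) (min t (T - 2 * r k)) (2 * r k)
      (min s (T - 2 * r k))
    have h2 := abs_min_sub_min_le_max t (T - 2 * r k) s (T - 2 * r k)
    simp only [sub_self, abs_zero] at h1 h2
    exact h1.trans (max_le (abs_nonneg _) (h2.trans (max_le le_rfl (abs_nonneg _))))
  have hLip : ∀ x ∈ Ω, ∀ t s, ∀ᶠ k in atTop,
      ‖F k (c k t, x) - F k (c k s, x)‖ ≤ L * |t - s| := by
    intro x hx t s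
    obtain ⟨ρ, hρ, hρΩ⟩ := Metric.isOpen_iff.1 hΩ x hx
    filter_upwards [hrlim.eventually (gt_mem_nhds hρ),
      hrlim.eventually (gt_mem_nhds (show (0 : ℝ) < T / 4 by positivity))] with k hk1 hk2
    have hmem : ∀ t, c k t ∈ Icc (2 * r k) (T - 2 * r k) := fun t =>
      ⟨le_max_left _ _, max_le (by linarith) (min_le_right _ _)⟩
    have hball : ∀ t ∈ Icc (2 * r k) (T - 2 * r k), Metric.closedBall (t, x) (φ k).rOut ⊆ Q :=
      fun t ht => closedBall_subset_spaceTimeCylinder (hr0 k)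
        ((Metric.closedBall_subset_ball hk1).trans hρΩ) ht.1 ht.2
    have hder : ∀ t ∈ Icc (2 * r k) (T - 2 * r k), HasDerivWithinAt (fun t => F k (t, x))
        (fderiv ℝ (F k) (t, x) ((1 : ℝ), 0)) (Icc (2 * r k) (T - 2 * r k)) t := fun t ht => by
      have h1 := (mollify_fderiv_bound (φ k) hQ.measurableSet hf0 hg hL0 hL (hball t ht)).1
      have h2 : HasDerivAt (fun t : ℝ => (t, x)) ((1 : ℝ), (0 : EuclideanSpace ℝ (Fin n))) t :=
        (hasDerivAt_id t).prodMk (hasDerivAt_const t x)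
      exact (h1.hasFDerivAt.comp_hasDerivAt t h2).hasDerivWithinAt
    have := (convex_Icc (2 * r k) (T - 2 * r k)).norm_image_sub_le_of_norm_hasDerivWithin_le hder
      (fun t ht => (mollify_fderiv_bound (φ k) hQ.measurableSet hf0 hg hL0 hL (hball t ht)).2)
      (hmem s) (hmem t)
    refine this.trans (mul_le_mul_of_nonneg_left ?_ hL0)
    exact hcl k t s
  -- The Lipschitz bound holds only eventually in `k`, at a rate depending on `x`, and convergence
  -- only almost everywhere. An upper limit exists at every point, is measurable and inherits the
  -- bound; being a real notion, it is taken of real and imaginary parts. Outside `Ω` the value is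
  -- zero, since no regularity in `x` is required.
  let A : (ℂ →L[ℝ] ℝ) → SpaceTime n → ℝ := fun P => {z : SpaceTime n | z.2 ∈ Ω}.indicator fun z =>
    limsup (fun k => P (F k (c k z.1, z.2))) atTop
  have hP : ∀ P : ℂ →L[ℝ] ℝ, ‖P‖ ≤ 1 → ∀ w : ℂ, |P w| ≤ ‖w‖ := fun P hP w => by
    simpa using (P.le_opNorm w).trans (mul_le_mul_of_nonneg_right hP (norm_nonneg w))
  have hAm : ∀ P, Measurable (A P) := fun P => by
    refine Measurable.indicator (Measurable.limsup fun k => ?_)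
      (hΩ.preimage continuous_snd).measurableSet
    have : Continuous fun z : SpaceTime n => P (F k (c k z.1, z.2)) :=
      P.continuous.comp ((hFc k).comp (((hc k).comp continuous_fst).prodMk continuous_snd))
    exact this.measurable
  have hAb : ∀ P : ℂ →L[ℝ] ℝ, ‖P‖ ≤ 1 → ∀ z, |A P z| ≤ M := fun P hP1 z => by
    by_cases hz : z.2 ∈ Ω
    · simp only [A, indicator_of_mem (show z ∈ {z : SpaceTime n | z.2 ∈ Ω} from hz)]
      exact abs_limsup_le fun k => (hP P hP1 _).trans (hF k _)
    · simp only [A, indicator_of_notMem (show z ∉ {z : SpaceTime n | z.2 ∈ Ω} from hz), abs_zero]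
      exact hM0
  have hAL : ∀ P : ℂ →L[ℝ] ℝ, ‖P‖ ≤ 1 → ∀ t s x, 0 ≤ s → |A P (t + s, x) - A P (t, x)| ≤ L * s :=
    fun P hP1 t s x hs => by
    by_cases hz : x ∈ Ω
    · simp only [A, indicator_of_mem (show (t + s, x) ∈ {z : SpaceTime n | z.2 ∈ Ω} from hz),
        indicator_of_mem (show (t, x) ∈ {z : SpaceTime n | z.2 ∈ Ω} from hz)]
      refine abs_limsup_sub_le (fun k => (hP P hP1 _).trans (hF k _))
        (fun k => (hP P hP1 _).trans (hF k _)) ?_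
      filter_upwards [hLip x hz (t + s) t] with k hk
      rw [← map_sub]
      refine (hP P hP1 _).trans (hk.trans_eq ?_)
      rw [add_sub_cancel_left, abs_of_nonneg hs]
    · simp only [A, indicator_of_notMem (show (t + s, x) ∉ {z : SpaceTime n | z.2 ∈ Ω} from hz),
        indicator_of_notMem (show (t, x) ∉ {z : SpaceTime n | z.2 ∈ Ω} from hz), sub_self, abs_zero]
      positivity
  have hconv : ∀ᵐ z : SpaceTime n, Tendsto (fun k => F k z) atTop (𝓝 (Q.indicator f z)) := by
    have := ContDiffBump.ae_convolution_tendsto_right_of_locallyIntegrable (φ := φ) (l := atTop)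
      (K := 2) (μ := (volume : Measure (SpaceTime n))) hrlim
      (Eventually.of_forall fun k => by simp only [φ]; linarith)
      (locallyIntegrable_indicator hQ.measurableSet hf0)
    filter_upwards [this] with z hz
    refine hz.congr fun k => ?_
    simp only [F, mollify]
    rw [convolution_flip]
  have hAeq : ∀ᵐ z ∂(volume.restrict Q), ∀ P : ℂ →L[ℝ] ℝ, A P z = P (f z) := by
    filter_upwards [ae_restrict_of_ae hconv, ae_restrict_mem hQ.measurableSet] with z hz hzQ P
    have hz2 : z.2 ∈ Ω := hzQ.2
    simp only [A, indicator_of_mem (show z ∈ {z : SpaceTime n | z.2 ∈ Ω} from hz2)]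
    rw [indicator_of_mem hzQ] at hz
    refine Tendsto.limsup_eq (((P.continuous.tendsto _).comp hz).congr' ?_)
    have h1 : (0 : ℝ) < z.1 / 2 := half_pos hzQ.1.1
    have h2 : (0 : ℝ) < (T - z.1) / 2 := half_pos (sub_pos.2 hzQ.1.2)
    filter_upwards [hrlim.eventually (gt_mem_nhds h1), hrlim.eventually (gt_mem_nhds h2)]
      with k hk1 hk2
    have : c k z.1 = z.1 := by
      simp only [c]
      rw [min_eq_left (by linarith), max_eq_right (by linarith)]
    rw [this]; rfl
  have hre : ‖Complex.reCLM‖ ≤ 1 := Complex.reCLM_norm.le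
  have him : ‖Complex.imCLM‖ ≤ 1 := Complex.imCLM_norm.le
  refine ⟨fun z => A Complex.reCLM z + A Complex.imCLM z * Complex.I, M + M, L + L, by positivity,
    by positivity, ?_, fun z => ?_, fun t s x hs => ?_, ?_⟩
  · exact (Complex.measurable_ofReal.comp (hAm _)).add
      ((Complex.measurable_ofReal.comp (hAm _)).mul_const _)
  · refine (norm_add_le _ _).trans ?_
    rw [norm_mul, Complex.norm_I, mul_one, Complex.norm_real, Complex.norm_real]
    exact add_le_add (hAb _ hre z) (hAb _ him z)
  · have e : ((A Complex.reCLM (t + s, x) : ℂ) + A Complex.imCLM (t + s, x) * Complex.I) -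
        (A Complex.reCLM (t, x) + A Complex.imCLM (t, x) * Complex.I) =
        ((A Complex.reCLM (t + s, x) - A Complex.reCLM (t, x) : ℝ) : ℂ) +
          ((A Complex.imCLM (t + s, x) - A Complex.imCLM (t, x) : ℝ) : ℂ) * Complex.I := by
      push_cast; ring
    rw [e]
    refine (norm_add_le _ _).trans ?_
    rw [norm_mul, Complex.norm_I, mul_one, Complex.norm_real, Complex.norm_real, add_mul]
    exact add_le_add (hAL _ hre t s x hs) (hAL _ him t s x hs)
  · filter_upwards [hAeq] with z hz
    rw [hz, hz]
    exact Complex.re_add_im (f z)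

end TimeExtension

/-! ### Bounded functions that are Lipschitz in time. -/

section TimeLipschitz

variable {n : ℕ} {a b : SpaceTime n → ℂ}

/-- A bounded measurable function on space-time which is Lipschitz in time. -/
structure IsTimeLipschitz (a : SpaceTime n → ℂ) : Prop where
  measurable : Measurable a
  exists_bound : ∃ C : ℝ, 0 ≤ C ∧ (∀ z, ‖a z‖ ≤ C) ∧
    ∀ t s x, 0 ≤ s → ‖a (t + s, x) - a (t, x)‖ ≤ C * s

theorem isTimeLipschitz_space {g : EuclideanSpace ℝ (Fin n) → ℂ} (hg : Measurable g) {C : ℝ}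
    (hC : ∀ x, ‖g x‖ ≤ C) : IsTimeLipschitz (fun z : SpaceTime n => g z.2) :=
  ⟨hg.comp measurable_snd, C, (norm_nonneg _).trans (hC 0), fun z => hC z.2,
    fun t s x hs => by simpa using mul_nonneg ((norm_nonneg _).trans (hC 0)) hs⟩

theorem IsTimeLipschitz.add (ha : IsTimeLipschitz a) (hb : IsTimeLipschitz b) :
    IsTimeLipschitz (fun z => a z + b z) := by
  obtain ⟨ham, C, hC, h1, h2⟩ := ha
  obtain ⟨hbm, D, hD, h3, h4⟩ := hb
  refine ⟨ham.add hbm, C + D, by positivity,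
    fun z => (norm_add_le _ _).trans (add_le_add (h1 z) (h3 z)), fun t s x hs => ?_⟩
  rw [add_sub_add_comm, add_mul]
  exact (norm_add_le _ _).trans (add_le_add (h2 t s x hs) (h4 t s x hs))

theorem IsTimeLipschitz.mul (ha : IsTimeLipschitz a) (hb : IsTimeLipschitz b) :
    IsTimeLipschitz (fun z => a z * b z) := by
  obtain ⟨ham, C, hC, h1, h2⟩ := ha
  obtain ⟨hbm, D, hD, h3, h4⟩ := hb
  refine ⟨ham.mul hbm, C * D + C * D, by positivity, fun z => ?_, fun t s x hs => ?_⟩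
  · rw [norm_mul]
    have : ‖a z‖ * ‖b z‖ ≤ C * D := mul_le_mul (h1 z) (h3 z) (norm_nonneg _) hC
    nlinarith [mul_nonneg hC hD]
  · have e : a (t + s, x) * b (t + s, x) - a (t, x) * b (t, x) =
        a (t + s, x) * (b (t + s, x) - b (t, x)) + (a (t + s, x) - a (t, x)) * b (t, x) := by ring
    rw [e, add_mul]
    refine (norm_add_le _ _).trans (add_le_add ?_ ?_)
    · rw [norm_mul, mul_assoc]
      exact mul_le_mul (h1 _) (h4 t s x hs) (norm_nonneg _) hC
    · rw [norm_mul]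
      calc _ ≤ C * s * D := mul_le_mul (h2 t s x hs) (h3 _) (norm_nonneg _) (by positivity)
        _ = C * D * s := by ring

theorem isTimeLipschitz_const (c : ℂ) : IsTimeLipschitz (fun _ : SpaceTime n => c) :=
  isTimeLipschitz_space (g := fun _ => c) measurable_const (fun _ => le_rfl)

theorem isTimeLipschitz_sum {ι : Type*} (s : Finset ι) {a : ι → SpaceTime n → ℂ}
    (ha : ∀ i, IsTimeLipschitz (a i)) : IsTimeLipschitz (fun z => ∑ i ∈ s, a i z) := by
  classical
  induction s using Finset.induction_on with
  | empty => simpa using isTimeLipschitz_const 0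
  | insert i s hi ih => simpa [Finset.sum_insert hi] using (ha i).add ih

theorem isTimeLipschitz_of_contDiff {α : ℝ → ℝ} (hα : ContDiff ℝ 1 α) (hc : HasCompactSupport α) :
    IsTimeLipschitz (fun z : SpaceTime n => (α z.1 : ℂ)) := by
  obtain ⟨C, hC⟩ := hα.lipschitzWith_of_hasCompactSupport hc (by simp)
  obtain ⟨M, hM⟩ := hc.exists_bound_of_continuous hα.continuous
  have hM0 : 0 ≤ M := (norm_nonneg _).trans (hM 0)
  refine ⟨Complex.measurable_ofReal.comp (hα.continuous.measurable.comp measurable_fst),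
    C + M, by positivity, fun z => ?_, fun t s x hs => ?_⟩
  · rw [Complex.norm_real]
    exact (hM _).trans (by linarith [C.2])
  · rw [← Complex.ofReal_sub, Complex.norm_real, ← dist_eq_norm]
    refine (hC.dist_le_mul _ _).trans ?_
    rw [Real.dist_eq, add_sub_cancel_left, abs_of_nonneg hs]
    exact mul_le_mul_of_nonneg_right (by linarith) hs

theorem isTimeLipschitz_exp_I (ζ : SpaceTime n) :
    IsTimeLipschitz (fun z => Complex.exp (-Complex.I * (spaceTimeInner ζ z : ℂ))) := by
  have hcont : Continuous fun z : SpaceTime n =>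
      Complex.exp (-Complex.I * (spaceTimeInner ζ z : ℂ)) := by
    unfold spaceTimeInner; fun_prop
  have hn : ∀ r : ℝ, ‖Complex.exp (-Complex.I * (r : ℂ))‖ = 1 := fun r => by
    have : -Complex.I * (r : ℂ) = ((-r : ℝ) : ℂ) * Complex.I := by push_cast; ring
    rw [this, Complex.norm_exp_ofReal_mul_I]
  refine ⟨hcont.measurable, 1 + |ζ.1|, by positivity, fun z => ?_, fun t s x hs => ?_⟩
  · rw [hn]; linarith [abs_nonneg ζ.1]
  · have e : Complex.exp (-Complex.I * (spaceTimeInner ζ (t + s, x) : ℂ)) -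
        Complex.exp (-Complex.I * (spaceTimeInner ζ (t, x) : ℂ)) =
        Complex.exp (-Complex.I * (spaceTimeInner ζ (t, x) : ℂ)) *
          (Complex.exp (Complex.I * ((-(ζ.1 * s) : ℝ) : ℂ)) - 1) := by
      rw [mul_sub, ← Complex.exp_add, mul_one]
      congr 2
      simp only [spaceTimeInner]
      push_cast
      ring
    rw [e, norm_mul, hn, one_mul]
    refine (Real.norm_exp_I_mul_ofReal_sub_one_le).trans ?_
    rw [norm_neg, norm_mul, Real.norm_eq_abs, Real.norm_of_nonneg hs]
    exact mul_le_mul_of_nonneg_right (by linarith) hs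

/-- The unit vector in the time direction. -/
noncomputable abbrev timeVec (n : ℕ) : EuclideanSpaceTime n :=
  WithLp.toLp 2 ((1 : ℝ), (0 : EuclideanSpace ℝ (Fin n)))

/-- The unit vectors in the space directions. -/
noncomputable abbrev spaceVec (k : Fin n) : EuclideanSpaceTime n :=
  WithLp.toLp 2 ((0 : ℝ), EuclideanSpace.single k (1 : ℝ))

theorem inner_timeVec (ξ : EuclideanSpaceTime n) : inner ℝ (timeVec n) ξ = ξ.fst := by
  rw [WithLp.prod_inner_apply]; simp

theorem inner_spaceVec (k : Fin n) (ξ : EuclideanSpaceTime n) :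
    inner ℝ (spaceVec k) ξ = ξ.snd k := by
  rw [WithLp.prod_inner_apply]; simp [EuclideanSpace.inner_single_left]

theorem norm_timeVec : ‖timeVec n‖ = 1 := by
  simp [timeVec]

/-- The increment under a time shift is pointwise `O(s)` and lives on a fixed bounded set, hence is
`O(s)` in `L²`. -/
theorem IsTimeLipschitz.exists_lpTranslate_bound (ha : IsTimeLipschitz a) {R : ℝ}
    (hR : ∀ y : EuclideanSpaceTime n, a (WithLp.ofLp y) ≠ 0 → ‖y‖ ≤ R) :
    ∃ f : Lp ℂ 2 (volume : Measure (EuclideanSpaceTime n)),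
      (f =ᵐ[volume] fun y => a (WithLp.ofLp y)) ∧ ∃ C, 0 ≤ C ∧ ∀ s : ℝ, 0 < s → s ≤ 1 →
        ‖lpTranslate (s • timeVec n) f - f‖ ≤ C * s := by
  obtain ⟨ham, C, hC, h1, h2⟩ := ha
  have hball : volume (Metric.closedBall (0 : EuclideanSpaceTime n) (R + 1)) ≠ ∞ :=
    measure_closedBall_lt_top.ne
  -- The radius is `R + 1` because shifts by `s ≤ 1` move the support by at most `1`.
  let b : Lp ℂ 2 (volume : Measure (EuclideanSpaceTime n)) :=
    indicatorConstLp 2 Metric.isClosed_closedBall.measurableSet hball (1 : ℂ)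
  have hb : ∀ᵐ y ∂(volume : Measure (EuclideanSpaceTime n)), ‖y‖ ≤ R + 1 → ‖b y‖ = 1 := by
    filter_upwards [indicatorConstLp_coeFn (p := 2) (hs := Metric.isClosed_closedBall.measurableSet)
      (hμs := hball) (c := (1 : ℂ))] with y hy hyR
    have : y ∈ Metric.closedBall (0 : EuclideanSpaceTime n) (R + 1) := by simpa using hyR
    simp only [b]
    rw [hy, indicator_of_mem this, norm_one]
  have hmeas : Measurable fun y : EuclideanSpaceTime n => a (WithLp.ofLp y) :=
    ham.comp (WithLp.volume_preserving_ofLp ℝ (EuclideanSpace ℝ (Fin n))).measurable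
  have hml : MemLp (fun y : EuclideanSpaceTime n => a (WithLp.ofLp y)) 2 volume := by
    refine MemLp.of_le_mul (c := C) (Lp.memLp b) hmeas.aestronglyMeasurable ?_
    filter_upwards [hb] with y hy
    by_cases h0 : a (WithLp.ofLp y) = 0
    · rw [h0, norm_zero]; positivity
    · rw [hy ((hR y h0).trans (by linarith)), mul_one]; exact h1 _
  refine ⟨hml.toLp, hml.coeFn_toLp, C * ‖b‖, by positivity, fun s hs hs1 => ?_⟩
  have : C * ‖b‖ * s = C * s * ‖b‖ := by ring
  rw [this]
  refine Lp.norm_le_mul_norm_of_ae_le_mul ?_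
  have h0 := (quasiMeasurePreserving_add_right (volume : Measure (EuclideanSpaceTime n))
    (s • timeVec n)).ae hml.coeFn_toLp
  filter_upwards [hb, Lp.coeFn_sub (lpTranslate (s • timeVec n) hml.toLp) hml.toLp,
    coeFn_lpTranslate (s • timeVec n) hml.toLp, hml.coeFn_toLp, h0] with y hy e1 e2 e3 e4
  rw [e1, Pi.sub_apply, e2, e3, e4]
  have e5 : WithLp.ofLp (y + s • timeVec n) = (y.fst + s, y.snd) := by
    ext <;> simp [timeVec]
  by_cases hyR : ‖y‖ ≤ R + 1
  · rw [hy hyR, mul_one, e5]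
    exact h2 _ _ _ hs.le
  · have z1 : a (WithLp.ofLp y) = 0 := by
      by_contra h; exact hyR ((hR y h).trans (by linarith))
    have z2 : a (WithLp.ofLp (y + s • timeVec n)) = 0 := by
      by_contra h
      have h3 := hR _ h
      have h4 : ‖y‖ ≤ ‖y + s • timeVec n‖ + ‖s • timeVec n‖ := by
        simpa using norm_sub_le (y + s • timeVec n) (s • timeVec n)
      rw [norm_smul, norm_timeVec, mul_one, Real.norm_of_nonneg hs.le] at h4
      exact hyR (by linarith)
    rw [z1, z2]; simp; positivity

end TimeLipschitz

/-! ### Solutions of the conjugated equation have two derivatives. -/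

section ConjugatedEquation

open scoped FourierTransform

variable {n : ℕ}

/-- The solution of `h D r̂ = F̂`, where `D` is the conjugated wave symbol, has two weak derivatives
in `L²` as soon as `F` has one time derivative in `L²`. -/
theorem exists_conjugated_weakDeriv {h : ℝ} (hh : 0 < h) {ω : EuclideanSpace ℝ (Fin n)}
    (hω : ‖ω‖ = 1) {r F : Lp ℂ 2 (volume : Measure (EuclideanSpaceTime n))}
    (hr : (𝓕 r : Lp ℂ 2 (volume : Measure (EuclideanSpaceTime n))) =ᵐ[volume] fun ξ =>
      ((h : ℂ) * waveSymbol h ω ξ)⁻¹ *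
        (𝓕 F : Lp ℂ 2 (volume : Measure (EuclideanSpaceTime n))) ξ)
    (hF : MemLp (fun ξ => (inner ℝ (timeVec n) ξ : ℂ) *
      (𝓕 F : Lp ℂ 2 (volume : Measure (EuclideanSpaceTime n))) ξ) 2 volume) :
    ∃ (d : EuclideanSpaceTime n → Lp ℂ 2 (volume : Measure (EuclideanSpaceTime n)))
      (dd : EuclideanSpaceTime n → EuclideanSpaceTime n →
        Lp ℂ 2 (volume : Measure (EuclideanSpaceTime n))),
      (∀ v, HasWeakDeriv univ v r (d v)) ∧ (∀ v w, HasWeakDeriv univ w (d v) (dd v w)) ∧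
      ∀ᵐ y ∂(volume : Measure (EuclideanSpaceTime n)), (h : ℂ) *
        ((dd (timeVec n) (timeVec n) y + 2 * (-((h⁻¹ + 1 : ℝ) : ℂ)) * d (timeVec n) y +
          (-((h⁻¹ + 1 : ℝ) : ℂ)) ^ 2 * r y) -
          ∑ k, (dd (spaceVec k) (spaceVec k) y + 2 * (-((ω k * h⁻¹ : ℝ) : ℂ)) * d (spaceVec k) y +
            (-((ω k * h⁻¹ : ℝ) : ℂ)) ^ 2 * r y)) = F y := by
  have hD : ∀ ξ, waveSymbol h ω ξ ≠ 0 := fun ξ => norm_pos_iff.1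
    ((inv_pos.2 hh).trans_le (inv_le_norm_waveSymbol hh hω ξ))
  obtain ⟨K, hK⟩ := exists_elliptic_bound_waveSymbol hh hω
  set rh : Lp ℂ 2 (volume : Measure (EuclideanSpaceTime n)) := 𝓕 r with hrh
  set Fh : Lp ℂ 2 (volume : Measure (EuclideanSpaceTime n)) := 𝓕 F with hFh
  have hml : MemLp (fun ξ => ((1 + ‖ξ‖ ^ 2 : ℝ) : ℂ) * rh ξ) 2 volume := by
    have hdom : MemLp (fun ξ => ‖Fh ξ‖ + ‖(inner ℝ (timeVec n) ξ : ℂ) * Fh ξ‖) 2 volume :=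
      (Lp.memLp Fh).norm.add hF.norm
    refine MemLp.of_le_mul (c := K / h) hdom ?_ ?_
    · have : Continuous fun ξ : EuclideanSpaceTime n => ((1 + ‖ξ‖ ^ 2 : ℝ) : ℂ) := by fun_prop
      exact this.aestronglyMeasurable.mul (Lp.aestronglyMeasurable rh)
    · filter_upwards [hr] with ξ hξ
      have hp : 0 < ‖waveSymbol h ω ξ‖ := norm_pos_iff.2 (hD ξ)
      have e1 : ‖(‖Fh ξ‖ + ‖(inner ℝ (timeVec n) ξ : ℂ) * Fh ξ‖)‖ =
          ‖Fh ξ‖ + |ξ.fst| * ‖Fh ξ‖ := by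
        rw [Real.norm_of_nonneg (by positivity), norm_mul, Complex.norm_real, inner_timeVec,
          Real.norm_eq_abs]
      have e2 : ‖((1 + ‖ξ‖ ^ 2 : ℝ) : ℂ) * (((h : ℂ) * waveSymbol h ω ξ)⁻¹ * Fh ξ)‖ =
          (1 + ‖ξ‖ ^ 2) * ((h * ‖waveSymbol h ω ξ‖)⁻¹ * ‖Fh ξ‖) := by
        rw [norm_mul, norm_mul, norm_inv, norm_mul, Complex.norm_real, Complex.norm_real,
          Real.norm_of_nonneg hh.le, Real.norm_of_nonneg (by positivity)]
      rw [hξ, e1, e2]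
      calc (1 + ‖ξ‖ ^ 2) * ((h * ‖waveSymbol h ω ξ‖)⁻¹ * ‖Fh ξ‖)
          ≤ (K * (‖waveSymbol h ω ξ‖ * (1 + |ξ.fst|))) *
            ((h * ‖waveSymbol h ω ξ‖)⁻¹ * ‖Fh ξ‖) :=
            mul_le_mul_of_nonneg_right (hK ξ) (by positivity)
        _ = K / h * (‖Fh ξ‖ + |ξ.fst| * ‖Fh ξ‖) := by field_simp
  obtain ⟨d, dd, h1, h2, h3, h4⟩ := exists_lp_weakDeriv (r := r) hml
  refine ⟨d, dd, h1, h2, ?_⟩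
  let c : ℂ := -((h⁻¹ + 1 : ℝ) : ℂ)
  let b : Fin n → ℂ := fun k => -((ω k * h⁻¹ : ℝ) : ℂ)
  -- `Z v c` is `(∂_v + c)² r`, whose transform is `(2πi⟨v,ξ⟩ + c)²` times that of `r`; the time
  -- term minus the space terms has symbol `waveSymbol`.
  let Z : EuclideanSpaceTime n → ℂ → Lp ℂ 2 (volume : Measure (EuclideanSpaceTime n)) := fun v c =>
    dd v v + (2 * c) • d v + (c ^ 2) • r
  let U : Lp ℂ 2 (volume : Measure (EuclideanSpaceTime n)) ≃ₗᵢ[ℂ]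
    Lp ℂ 2 (volume : Measure (EuclideanSpaceTime n)) := Lp.fourierTransformₗᵢ _ ℂ
  have hZ : ∀ v c, Z v c =ᵐ[volume] fun y => dd v v y + 2 * c * d v y + c ^ 2 * r y := by
    intro v c
    filter_upwards [Lp.coeFn_add (dd v v + (2 * c) • d v) ((c ^ 2) • r),
      Lp.coeFn_add (dd v v) ((2 * c) • d v), Lp.coeFn_smul (2 * c) (d v),
      Lp.coeFn_smul (c ^ 2) r] with y a1 a2 a3 a4
    simp only [Z]
    rw [a1, Pi.add_apply, a2, Pi.add_apply, a3, a4]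
    simp
  have hZF : ∀ v c, (U (Z v c) : EuclideanSpaceTime n → ℂ) =ᵐ[volume] fun ξ =>
      (2 * Real.pi * Complex.I * (inner ℝ v ξ : ℂ) + c) ^ 2 * rh ξ := by
    intro v c
    have e : U (Z v c) = U (dd v v) + (2 * c) • U (d v) + (c ^ 2) • U r := by
      simp only [Z, map_add, map_smul]
    rw [e]
    have h3' : (U (d v) : EuclideanSpaceTime n → ℂ) =ᵐ[volume] _ := h3 v
    have h4' : (U (dd v v) : EuclideanSpaceTime n → ℂ) =ᵐ[volume] _ := h4 v v
    filter_upwards [Lp.coeFn_add (U (dd v v) + (2 * c) • U (d v)) ((c ^ 2) • U r),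
      Lp.coeFn_add (U (dd v v)) ((2 * c) • U (d v)), Lp.coeFn_smul (2 * c) (U (d v)),
      Lp.coeFn_smul (c ^ 2) (U r), h3', h4'] with ξ a1 a2 a3 a4 a5 a6
    rw [a1, Pi.add_apply, a2, Pi.add_apply, a3, a4, Pi.smul_apply, Pi.smul_apply, a5, a6]
    change _ + _ + c ^ 2 • rh ξ = _
    simp only [smul_eq_mul]
    ring
  have hmain : (h : ℂ) • (Z (timeVec n) c - ∑ k, Z (spaceVec k) (b k)) = F := by
    apply U.injective
    have e : U ((h : ℂ) • (Z (timeVec n) c - ∑ k, Z (spaceVec k) (b k))) =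
        (h : ℂ) • (U (Z (timeVec n) c) - ∑ k, U (Z (spaceVec k) (b k))) := by
      simp only [map_smul, map_sub, map_sum]
    rw [e]
    apply Lp.ext
    have hall : ∀ᵐ ξ ∂(volume : Measure (EuclideanSpaceTime n)), ∀ k, U (Z (spaceVec k) (b k)) ξ =
        (2 * Real.pi * Complex.I * (inner ℝ (spaceVec k) ξ : ℂ) + b k) ^ 2 * rh ξ :=
      ae_all_iff.2 fun k => hZF _ _
    filter_upwards [Lp.coeFn_smul (h : ℂ) (U (Z (timeVec n) c) - ∑ k, U (Z (spaceVec k) (b k))),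
      Lp.coeFn_sub (U (Z (timeVec n) c)) (∑ k, U (Z (spaceVec k) (b k))),
      Lp.coeFn_fun_finsetSum Finset.univ fun k => U (Z (spaceVec k) (b k)), hZF (timeVec n) c, hall,
      hr] with ξ a1 a2 a3 a4 a5 a6
    rw [a1, Pi.smul_apply, a2, Pi.sub_apply, a3, a4, smul_eq_mul]
    simp only [a5, inner_timeVec, inner_spaceVec]
    rw [← Finset.sum_mul, ← sub_mul, a6]
    change _ = Fh ξ
    have hsym : (2 * Real.pi * Complex.I * (ξ.fst : ℂ) + c) ^ 2 -
        ∑ k, (2 * Real.pi * Complex.I * (ξ.snd k : ℂ) + b k) ^ 2 = waveSymbol h ω ξ := by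
      simp only [waveSymbol, c, b, sub_eq_add_neg]
    rw [hsym]
    have hh' : (h : ℂ) ≠ 0 := by exact_mod_cast hh.ne'
    have := hD ξ
    field_simp
  have hall : ∀ᵐ y ∂(volume : Measure (EuclideanSpaceTime n)), ∀ k, Z (spaceVec k) (b k) y =
      dd (spaceVec k) (spaceVec k) y + 2 * b k * d (spaceVec k) y + b k ^ 2 * r y :=
    ae_all_iff.2 fun k => hZ _ _
  rw [← hmain]
  filter_upwards [Lp.coeFn_smul (h : ℂ) (Z (timeVec n) c - ∑ k, Z (spaceVec k) (b k)),
      Lp.coeFn_sub (Z (timeVec n) c) (∑ k, Z (spaceVec k) (b k)),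
      Lp.coeFn_fun_finsetSum Finset.univ fun k => Z (spaceVec k) (b k), hZ (timeVec n) c, hall]
      with y a1 a2 a3 a4 a5
  rw [a1, Pi.smul_apply, a2, Pi.sub_apply, a3, a4, smul_eq_mul]
  simp only [a5, c, b]

/-- The complex linear functional `(t, x) ↦ c t + ∑ₖ b_k x_k`. -/
noncomputable def linearPhase (c : ℂ) (b : Fin n → ℂ) : SpaceTime n →L[ℝ] ℂ :=
  c • (Complex.ofRealCLM.comp (ContinuousLinearMap.fst ℝ ℝ (EuclideanSpace ℝ (Fin n)))) +
    ∑ k, b k • (Complex.ofRealCLM.comp ((EuclideanSpace.proj k).comp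
      (ContinuousLinearMap.snd ℝ ℝ (EuclideanSpace ℝ (Fin n)))))

theorem linearPhase_apply (c : ℂ) (b : Fin n → ℂ) (z : SpaceTime n) :
    linearPhase c b z = c * z.1 + ∑ k, b k * z.2 k := by
  simp [linearPhase]

theorem linearPhase_time (c : ℂ) (b : Fin n → ℂ) : linearPhase c b ((1 : ℝ), 0) = c := by
  simp [linearPhase_apply]

theorem linearPhase_space (c : ℂ) (b : Fin n → ℂ) (k : Fin n) :
    linearPhase c b ((0 : ℝ), EuclideanSpace.single k (1 : ℝ)) = b k := by
  rw [linearPhase_apply, Finset.sum_eq_single k] <;> simp +contextual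

theorem ofReal_phase (ω : EuclideanSpace ℝ (Fin n)) (z : SpaceTime n) :
    (phase ω z : ℂ) = z.1 + ∑ k, (ω k : ℂ) * z.2 k := by
  simp [phase, PiLp.inner_apply]

theorem ofReal_spaceTimeInner (ζ z : SpaceTime n) :
    (spaceTimeInner ζ z : ℂ) = ζ.1 * z.1 + ∑ k, (ζ.2 k : ℂ) * z.2 k := by
  simp [spaceTimeInner, PiLp.inner_apply, mul_comm]

end ConjugatedEquation

/-! ### The remainder and its source term. -/

section Remainder

open scoped FourierTransform

variable {n : ℕ}

theorem setIntegral_norm_sq_comp_toLp_le (Q : Set (SpaceTime n))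
    (r : Lp ℂ 2 (volume : Measure (EuclideanSpaceTime n))) :
    ∫ z in Q, ‖r (WithLp.toLp 2 z)‖ ^ 2 ≤ ‖r‖ ^ 2 := by
  have hi : Integrable (fun z : SpaceTime n => ‖r (WithLp.toLp 2 z)‖ ^ 2) volume :=
    (memLp_comp_toLp r).norm.integrable_sq
  calc _ ≤ ∫ z : SpaceTime n, ‖r (WithLp.toLp 2 z)‖ ^ 2 :=
        setIntegral_le_integral hi (ae_of_all _ fun z => by positivity)
    _ = ∫ y, ‖r y‖ ^ 2 := EuclideanSpaceTime.measurePreserving_toLp.integral_comp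
        (WithLp.prodContinuousLinearEquiv 2 ℝ ℝ
          (EuclideanSpace ℝ (Fin n))).symm.toHomeomorph.measurableEmbedding
        (fun y => ‖r y‖ ^ 2)
    _ = ‖r‖ ^ 2 := by
        have h1 : inner ℂ r r = ((‖r‖ ^ 2 : ℝ) : ℂ) := by
          rw [inner_self_eq_norm_sq_to_K]; simp
        rw [L2.inner_def] at h1
        refine Complex.ofReal_injective ?_
        rw [← h1, ← integral_complex_ofReal]
        refine integral_congr_ae (ae_of_all _ fun y => ?_)
        simp only
        rw [inner_self_eq_norm_sq_to_K]; simp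

/-- Here `Y` is the conjugated wave operator applied to `r`. The lower bound `1/h` on the symbol
makes the multiplier `(hD)⁻¹` at most `1` in modulus, so the `L²` bound does not involve `h`. -/
theorem exists_remainder {Q : Set (SpaceTime n)} (hQ : IsOpen Q) {ω : EuclideanSpace ℝ (Fin n)}
    (hω : ‖ω‖ = 1) {a : Fin n → Fin n → SpaceTime n → ℂ} {M C : ℝ} (hM : 0 ≤ M) (hC : 0 ≤ C)
    (ham : ∀ i j, Measurable (a i j)) (haM : ∀ i j z, ‖a i j z‖ ≤ M)
    (haL : ∀ i j t s x, 0 ≤ s → ‖a i j (t + s, x) - a i j (t, x)‖ ≤ M * s)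
    {f : Fin n → Lp ℂ 2 (volume : Measure (EuclideanSpaceTime n))}
    (hf : ∀ i (s : ℝ), 0 < s → s ≤ 1 → ‖lpTranslate (s • timeVec n) (f i) - f i‖ ≤ C * s)
    {h : ℝ} (hh : 0 < h) (hhM : h * (n * M) ≤ 1 / 2) :
    ∃ r Y : Fin n → SpaceTime n → ℂ, (∀ i, MemSobolevOn Q 2 2 (r i)) ∧
      (∀ i, ∫ z in Q, ‖r i z‖ ^ 2 ≤ (2 * ‖f‖) ^ 2) ∧
      (∀ i, HasWeakBox Q
        (fun z => Complex.exp (linearPhase (-((h⁻¹ + 1 : ℝ) : ℂ))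
          (fun k => -((ω k * h⁻¹ : ℝ) : ℂ)) z) * r i z)
        (fun z => Complex.exp (linearPhase (-((h⁻¹ + 1 : ℝ) : ℂ))
          (fun k => -((ω k * h⁻¹ : ℝ) : ℂ)) z) * Y i z)) ∧
      ∀ᵐ z ∂(volume.restrict Q), ∀ i,
        (h : ℂ) * Y i z = f i (WithLp.toLp 2 z) - (h : ℂ) * ∑ j, a i j z * r j z := by
  have hofm : Measurable (WithLp.ofLp : EuclideanSpaceTime n → SpaceTime n) :=
    (WithLp.volume_preserving_ofLp ℝ (EuclideanSpace ℝ (Fin n))).measurable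
  obtain ⟨r, F, hF, hr, hrn, hFt⟩ := exists_multiplier_system (e := timeVec n)
    (m := fun ξ => ((h : ℂ) * waveSymbol h ω ξ)⁻¹) (a := fun i j y => a i j (WithLp.ofLp y))
    (M := M) (L := M) (C := C) (f := f) (ε := h)
    ((continuous_const.mul (continuous_waveSymbol h ω)).measurable.inv.aestronglyMeasurable)
    (fun ξ => by
      rw [norm_inv, norm_mul, Complex.norm_real, Real.norm_of_nonneg hh.le]
      refine inv_le_one_of_one_le₀ ?_
      calc (1 : ℝ) = h * h⁻¹ := (mul_inv_cancel₀ hh.ne').symm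
        _ ≤ _ := mul_le_mul_of_nonneg_left (inv_le_norm_waveSymbol hh hω ξ) hh.le)
    hM hM hC (fun i j => ((ham i j).comp hofm).aestronglyMeasurable) (fun i j y => haM i j _)
    (fun i j y s hs => by
      have e : WithLp.ofLp (y + s • timeVec n) = (y.fst + s, y.snd) := by
        ext <;> simp [timeVec]
      rw [e]
      exact haL i j y.fst s y.snd hs) hf hh.le (by simpa using hhM)
  choose d dd hd hdd hbox using fun i => exists_conjugated_weakDeriv hh hω (hr i) (hFt i)
  have hmp := EuclideanSpaceTime.measurePreserving_toLp (n := n)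
  refine ⟨fun i z => r i (WithLp.toLp 2 z), fun i z =>
    (dd i (timeVec n) (timeVec n) (WithLp.toLp 2 z) +
      2 * (-((h⁻¹ + 1 : ℝ) : ℂ)) * d i (timeVec n) (WithLp.toLp 2 z) +
      (-((h⁻¹ + 1 : ℝ) : ℂ)) ^ 2 * r i (WithLp.toLp 2 z)) -
      ∑ k, (dd i (spaceVec k) (spaceVec k) (WithLp.toLp 2 z) +
        2 * (-((ω k * h⁻¹ : ℝ) : ℂ)) * d i (spaceVec k) (WithLp.toLp 2 z) +
        (-((ω k * h⁻¹ : ℝ) : ℂ)) ^ 2 * r i (WithLp.toLp 2 z)),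
    fun i => ?_, fun i => ?_, fun i => ?_, ?_⟩
  · have hl : ∀ g : Lp ℂ 2 (volume : Measure (EuclideanSpaceTime n)),
        MemLp (fun z : SpaceTime n => g (WithLp.toLp 2 z)) 2 (volume.restrict Q) := fun g =>
      (memLp_comp_toLp g).restrict Q
    exact ⟨hl _, fun v => ⟨_, (hd i (WithLp.toLp 2 v)).comp_toLp.restrict Q, hl _, fun w =>
      ⟨_, (hdd i (WithLp.toLp 2 v) (WithLp.toLp 2 w)).comp_toLp.restrict Q, hl _⟩⟩⟩
  · refine (setIntegral_norm_sq_comp_toLp_le Q (r i)).trans ?_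
    exact pow_le_pow_left₀ (norm_nonneg _) ((norm_le_pi_norm r i).trans hrn) 2
  · exact hasWeakBox_exp_mul hQ ((hd i _).comp_toLp.restrict Q) ((hdd i _ _).comp_toLp.restrict Q)
      (fun k => (hd i (spaceVec k)).comp_toLp.restrict Q)
      (fun k => (hdd i (spaceVec k) (spaceVec k)).comp_toLp.restrict Q)
      _ (linearPhase_time _ _) (fun k => linearPhase_space _ _ k)
  · refine ae_restrict_of_ae ?_
    have h1 := hmp.quasiMeasurePreserving.ae (ae_all_iff.2 hbox)
    have h2 := hmp.quasiMeasurePreserving.ae (ae_all_iff.2 hF)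
    filter_upwards [h1, h2] with z h1 h2 i
    rw [h1 i, h2 i]

/-- The weight `e^t` has to be cut off in time to become bounded and Lipschitz on the whole line. -/
theorem exists_exp_cutoff {T : ℝ} (hT : 0 < T) :
    ∃ α : ℝ → ℝ, ContDiff ℝ 1 α ∧ HasCompactSupport α ∧ ∀ t ∈ Ioo 0 T, α t = Real.exp t := by
  let χ : ContDiffBump (T / 2) := ⟨T / 2, T, half_pos hT, half_lt_self hT⟩
  refine ⟨fun t => χ t * Real.exp t, χ.contDiff.mul Real.contDiff_exp,
    χ.hasCompactSupport.mul_right, fun t ht => ?_⟩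
  have : t ∈ Metric.closedBall (T / 2) χ.rIn := by
    rw [Real.closedBall_eq_Icc]
    exact ⟨by simp only [χ]; linarith [ht.1], by simp only [χ]; linarith [ht.2]⟩
  simp only
  rw [χ.one_of_mem_closedBall this, one_mul]

/-- A bounded time-Lipschitz function times `e^t` on a bounded cylinder extends to an `L²` function
on space-time with one time derivative in `L²`. -/
theorem exists_source {Ω : Set (EuclideanSpace ℝ (Fin n))} (hΩ : IsOpen Ω)
    (hΩb : Bornology.IsBounded Ω) {T : ℝ} (hT : 0 < T) {η : SpaceTime n → ℂ}
    (hη : IsTimeLipschitz η) :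
    ∃ f : Lp ℂ 2 (volume : Measure (EuclideanSpaceTime n)),
      (∀ᵐ z ∂(volume.restrict (spaceTimeCylinder T Ω)),
        f (WithLp.toLp 2 z) = Complex.exp z.1 * η z) ∧
      ∃ C, 0 ≤ C ∧ ∀ s : ℝ, 0 < s → s ≤ 1 → ‖lpTranslate (s • timeVec n) f - f‖ ≤ C * s := by
  obtain ⟨α, hα, hαc, hαe⟩ := exists_exp_cutoff hT
  have h1 : IsTimeLipschitz (fun z : SpaceTime n => (α z.1 : ℂ)) :=
    isTimeLipschitz_of_contDiff hα hαc
  have h2 : IsTimeLipschitz (fun z : SpaceTime n => Ω.indicator (fun _ => (1 : ℂ)) z.2) :=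
    isTimeLipschitz_space (C := 1) (measurable_const.indicator hΩ.measurableSet) fun x =>
      (norm_indicator_le_norm_self _ _).trans (by simp)
  have h3 := (h1.mul h2).mul hη
  obtain ⟨A, hA⟩ := hαc.isCompact.isBounded.exists_norm_le
  obtain ⟨B, hB⟩ := hΩb.exists_norm_le
  obtain ⟨f, hf, hfC⟩ := h3.exists_lpTranslate_bound (R := A + B) fun y hy => by
    have hy1 : α y.fst ≠ 0 := fun h0 => hy (by simp [h0])
    have hy2 : y.snd ∈ Ω := by
      by_contra h0; exact hy (by simp [h0])
    have e1 := hA _ (subset_tsupport α hy1)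
    have e2 := hB _ hy2
    have e3 : ‖y‖ ^ 2 ≤ (‖y.fst‖ + ‖y.snd‖) ^ 2 := by
      rw [WithLp.prod_norm_sq_eq_of_L2]
      nlinarith [norm_nonneg y.fst, norm_nonneg y.snd]
    have e4 := abs_le_of_sq_le_sq' e3 (by positivity)
    linarith [e4.2]
  refine ⟨f, ?_, hfC⟩
  have h4 := EuclideanSpaceTime.measurePreserving_toLp.quasiMeasurePreserving.ae hf
  filter_upwards [ae_restrict_of_ae h4, ae_restrict_mem
    (isOpen_spaceTimeCylinder (T := T) hΩ).measurableSet] with z hz hzQ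
  rw [hz]
  have hz2 : z.2 ∈ Ω := hzQ.2
  simp [hz2, hαe z.1 hzQ.1]

end Remainder

/-! ### Assembly of the geometric optics solution. -/

theorem proposition5p2 (n : ℕ) (hn : 2 ≤ n)
    (Ω : Set (EuclideanSpace ℝ (Fin n))) (hΩ : IsOpen Ω) (hΩb : Bornology.IsBounded Ω)
    (hΩ2 : HasC2Boundary Ω) (T : ℝ) (hT : 0 < T)
    (q : SpaceTime n → Matrix (Fin n) (Fin n) ℂ)
    (hq : ∀ i j, MemSobolevOn (spaceTimeCylinder T Ω) ∞ 1 (fun z => q z i j))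
    (ω : EuclideanSpace ℝ (Fin n)) (hω : ‖ω‖ = 1) :
    ∃ h₀ : ℝ, 0 < h₀ ∧
      ∀ (ζ : SpaceTime n) (K₁ : Fin n → ℂ), spaceTimeInner ζ ((1 : ℝ), -ω) = 0 →
        ∃ C : ℝ, ∀ h : ℝ, 0 < h → h ≤ h₀ →
          ∃ v R : SpaceTime n → Fin n → ℂ,
            MemVectorH2 (spaceTimeCylinder T Ω) v ∧
            SolvesWaveSystem (spaceTimeCylinder T Ω) (fun z => (q z)ᴴ) v ∧
            (∀ z ∈ spaceTimeCylinder T Ω,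
              v z = (Real.exp (-phase ω z / h) : ℂ) • (amplitude ζ K₁ z + (h : ℂ) • R z)) ∧
            MemVectorH2 (spaceTimeCylinder T Ω) R ∧
            vectorL2Norm (spaceTimeCylinder T Ω) R ≤ C := by
  set Q := spaceTimeCylinder T Ω
  have hQ : IsOpen Q := isOpen_spaceTimeCylinder hΩ
  have hQb : Bornology.IsBounded Q := isBounded_spaceTimeCylinder hΩb
  choose p Mp Np hMp hNp hpm hpM hpL hpq using fun i j =>
    exists_timeLipschitz_extension hΩ hT (hq i j)
  let a : Fin n → Fin n → SpaceTime n → ℂ := fun i j z => star (p j i z)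
  -- A single constant dominates all the sup bounds and all the Lipschitz constants in time.
  let M : ℝ := ∑ i, ∑ j, (Mp i j + Np i j)
  have hMij : ∀ i j, Mp i j + Np i j ≤ M := fun i j => by
    have h1 : ∀ i j, 0 ≤ Mp i j + Np i j := fun i j => add_nonneg (hMp i j) (hNp i j)
    exact (Finset.single_le_sum (f := fun j => Mp i j + Np i j) (fun j _ => h1 i j)
      (Finset.mem_univ j)).trans (Finset.single_le_sum (f := fun i => ∑ j, (Mp i j + Np i j))
      (fun i _ => Finset.sum_nonneg fun j _ => h1 i j) (Finset.mem_univ i))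
  have hM : 0 ≤ M := Finset.sum_nonneg fun i _ => Finset.sum_nonneg fun j _ =>
    add_nonneg (hMp i j) (hNp i j)
  have ham : ∀ i j, Measurable (a i j) := fun i j => continuous_star.measurable.comp (hpm j i)
  have haM : ∀ i j z, ‖a i j z‖ ≤ M := fun i j z => by
    simp only [a]
    rw [norm_star]
    exact (hpM j i z).trans (by linarith [hMij j i, hNp j i])
  have haL : ∀ i j t s x, 0 ≤ s → ‖a i j (t + s, x) - a i j (t, x)‖ ≤ M * s :=
    fun i j t s x hs => by
      simp only [a]
      rw [← star_sub, norm_star]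
      exact (hpL j i t s x hs).trans
        (mul_le_mul_of_nonneg_right (by linarith [hMij j i, hMp j i]) hs)
  have haq : ∀ᵐ z ∂(volume.restrict Q), ∀ i j, a i j z = (q z)ᴴ i j := by
    have := ae_all_iff.2 fun i => ae_all_iff.2 fun j => hpq i j
    filter_upwards [this] with z hz i j
    simp only [a, hz, Matrix.conjTranspose_apply]
  -- This choice gives `h n M ≤ 1/2`, the contraction condition, and depends only on `n` and `q`;
  -- the `+ 1` covers `M = 0`.
  refine ⟨1 / (2 * (n * M + 1)), by positivity, fun ζ K₁ hζ => ?_⟩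
  let κ : ℂ := ∑ k, (ζ.2 k : ℂ) ^ 2 - (ζ.1 : ℂ) ^ 2
  have hB : ∀ j, IsTimeLipschitz (fun z => amplitude ζ K₁ z j) := fun j =>
    (isTimeLipschitz_exp_I ζ).mul (isTimeLipschitz_const (K₁ j))
  -- The negative of the error left by the leading amplitude, `κB + q*B`; it serves as source once
  -- multiplied by `e^t`.
  have hη : ∀ i, IsTimeLipschitz (fun z => (-1 : ℂ) * (κ * amplitude ζ K₁ z i +
      ∑ j, a i j z * amplitude ζ K₁ z j)) := fun i =>
    (isTimeLipschitz_const _).mul (((isTimeLipschitz_const κ).mul (hB i)).add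
      (isTimeLipschitz_sum _ fun j =>
        IsTimeLipschitz.mul ⟨ham i j, M, hM, haM i j, haL i j⟩ (hB j)))
  choose f hf Cf hCf hfC using fun i => exists_source hΩ hΩb hT (hη i)
  have hfC' : ∀ i (s : ℝ), 0 < s → s ≤ 1 →
      ‖lpTranslate (s • timeVec n) (f i) - f i‖ ≤ (∑ i, Cf i) * s := fun i s hs hs1 =>
    (hfC i s hs hs1).trans (mul_le_mul_of_nonneg_right
      (Finset.single_le_sum (fun i _ => hCf i) (Finset.mem_univ i)) hs.le)
  -- The source `f` was chosen before `h`, so this bound is uniform in `h`.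
  refine ⟨Real.sqrt (n * (2 * ‖f‖) ^ 2), fun h hh hh0 => ?_⟩
  have hhM : h * (n * M) ≤ 1 / 2 := by
    have h1 : 0 ≤ n * M := by positivity
    rw [le_div_iff₀ (by positivity)] at hh0
    nlinarith
  obtain ⟨r, Y, hrH, hrn, hrbox, hYeq⟩ := exists_remainder hQ hω hM
    (Finset.sum_nonneg fun i _ => hCf i) ham haM haL hfC' hh hhM
  set ℓ := linearPhase (-((h⁻¹ + 1 : ℝ) : ℂ)) (fun k => -((ω k * h⁻¹ : ℝ) : ℂ))
  -- The exponents: `ℓ = -φ/h - t` is the one used for the remainder, `ℓ₁ = -φ/h - iζ·(t,x)` is that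
  -- of the leading term, and `ℓ₀ = -t` turns `r` into `R`.
  let ℓ₁ : SpaceTime n →L[ℝ] ℂ := linearPhase (-(h⁻¹ : ℝ) - Complex.I * ζ.1)
    (fun k => -((ω k * h⁻¹ : ℝ) : ℂ) - Complex.I * ζ.2 k)
  let ℓ₀ : SpaceTime n →L[ℝ] ℂ := linearPhase (-1) 0
  have hhC : (h : ℂ) ≠ 0 := by exact_mod_cast hh.ne'
  let R : SpaceTime n → Fin n → ℂ := fun z i => Complex.exp (ℓ₀ z) * r i z
  let v : SpaceTime n → Fin n → ℂ := fun z =>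
    (Real.exp (-phase ω z / h) : ℂ) • (amplitude ζ K₁ z + (h : ℂ) • R z)
  have hℓ₀ : ∀ z, ℓ₀ z = -(z.1 : ℂ) := fun z => by simp [ℓ₀, linearPhase_apply]
  have hphase : ∀ z, ((-phase ω z / h : ℝ) : ℂ) =
      -((h⁻¹ : ℝ) : ℂ) * z.1 + ∑ k, (-((ω k * h⁻¹ : ℝ) : ℂ)) * z.2 k := fun z => by
    have e : ∑ k, (-((ω k * h⁻¹ : ℝ) : ℂ)) * z.2 k = -((h⁻¹ : ℝ) : ℂ) * ∑ k, (ω k : ℂ) * z.2 k := by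
      rw [Finset.mul_sum]
      exact Finset.sum_congr rfl fun k _ => by push_cast; ring
    rw [e, Complex.ofReal_div, Complex.ofReal_neg, ofReal_phase]
    push_cast
    field_simp
    ring
  have hexp₁ : ∀ z, Complex.exp (ℓ₁ z) = (Real.exp (-phase ω z / h) : ℂ) *
      Complex.exp (-Complex.I * (spaceTimeInner ζ z : ℂ)) := fun z => by
    rw [Complex.ofReal_exp, ← Complex.exp_add, hphase, ofReal_spaceTimeInner]
    congr 1
    simp only [ℓ₁, linearPhase_apply]
    rw [mul_add, Finset.mul_sum, add_add_add_comm, ← Finset.sum_add_distrib]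
    congr 1
    · ring
    · exact Finset.sum_congr rfl fun k _ => by ring
  have hexp : ∀ z, Complex.exp (ℓ z) = (Real.exp (-phase ω z / h) : ℂ) * Complex.exp (-(z.1 : ℂ)) :=
    fun z => by
      rw [Complex.ofReal_exp, ← Complex.exp_add, hphase]
      congr 1
      simp only [ℓ, linearPhase_apply]
      push_cast
      ring
  have hv : ∀ z i, v z i = K₁ i * Complex.exp (ℓ₁ z) + (h : ℂ) * (Complex.exp (ℓ z) * r i z) :=
    fun z i => by
      simp only [v, R, amplitude, Pi.smul_apply, Pi.add_apply, smul_eq_mul, hexp₁, hexp, hℓ₀]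
      ring
  -- The `h⁻²` terms cancel by the eikonal identity `|ω| = 1`, the `h⁻¹` terms by `ζ₀ = ω·ζ'`, where
  -- `ζ'` is the spatial part of `ζ`.
  have hκ : (-((h⁻¹ : ℝ) : ℂ) - Complex.I * ζ.1) ^ 2 -
      ∑ k, (-((ω k * h⁻¹ : ℝ) : ℂ) - Complex.I * ζ.2 k) ^ 2 = κ := by
    have h1 : ∑ k, (ω k : ℂ) ^ 2 = 1 := by
      have := EuclideanSpace.real_norm_sq_eq ω
      rw [hω] at this
      have h2 : ∑ k, ω k ^ 2 = 1 := by simpa using this.symm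
      exact_mod_cast congrArg (fun x : ℝ => (x : ℂ)) h2
    have h2 : (ζ.1 : ℂ) = ∑ k, (ω k : ℂ) * ζ.2 k := by
      have : ζ.1 = ∑ k, ω k * ζ.2 k := by
        have h3 : ζ.1 * 1 + inner ℝ ζ.2 (-ω) = 0 := hζ
        rw [inner_neg_right, PiLp.inner_apply] at h3
        simp only [RCLike.inner_apply, conj_trivial] at h3
        linarith
      rw [this]; push_cast; rfl
    have h3 : ∀ k, (-((ω k * h⁻¹ : ℝ) : ℂ) - Complex.I * ζ.2 k) ^ 2 =
        (ω k : ℂ) ^ 2 * ((h⁻¹ : ℝ) : ℂ) ^ 2 +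
          2 * Complex.I * ((h⁻¹ : ℝ) : ℂ) * ((ω k : ℂ) * ζ.2 k) - (ζ.2 k : ℂ) ^ 2 := fun k => by
      push_cast
      linear_combination (ζ.2 k : ℂ) ^ 2 * Complex.I_sq
    simp only [h3, κ]
    rw [Finset.sum_sub_distrib, Finset.sum_add_distrib, ← Finset.sum_mul, ← Finset.mul_sum, h1, ← h2]
    linear_combination (ζ.1 : ℂ) ^ 2 * Complex.I_sq
  have hvH : MemVectorH2 Q v := fun i => by
    have h1 : MemSobolevOn Q 2 2 (fun z => Complex.exp (ℓ₁ z) * K₁ i) :=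
      (memSobolevOn_const hQb 2 (K₁ i)).exp_mul hQ hQb ℓ₁
    have h2 := h1.add (((hrH i).exp_mul hQ hQb ℓ).const_mul (h : ℂ))
    have e : (fun z => v z i) = fun z => Complex.exp (ℓ₁ z) * K₁ i +
        (h : ℂ) * (Complex.exp (ℓ z) * r i z) := by
      ext z; rw [hv]; ring
    rw [e]; exact h2
  have hRH : MemVectorH2 Q R := fun i => (hrH i).exp_mul hQ hQb ℓ₀
  refine ⟨v, R, hvH, ?_, fun z _ => rfl, hRH, ?_⟩
  · refine ⟨fun z i => K₁ i * (Complex.exp (ℓ₁ z) * κ) + (h : ℂ) * (Complex.exp (ℓ z) * Y i z),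
      fun i => ?_, ?_⟩
    · have h1 := hasWeakBox_exp hQ ℓ₁ (linearPhase_time _ _) (fun k => linearPhase_space _ _ k)
      rw [hκ] at h1
      have h2 := (h1.const_mul (K₁ i)).add ((hrbox i).const_mul (h : ℂ))
      have e : (fun z => v z i) = fun z => K₁ i * Complex.exp (ℓ₁ z) +
          (h : ℂ) * (Complex.exp (ℓ z) * r i z) := by
        ext z; rw [hv]
      rw [e]; exact h2
    · filter_upwards [hYeq, haq, ae_all_iff.2 hf] with z h1 h2 h3 i
      have h4 : (h : ℂ) * Y i z = Complex.exp z.1 * ((-1 : ℂ) * (κ * amplitude ζ K₁ z i +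
          ∑ j, a i j z * amplitude ζ K₁ z j)) - (h : ℂ) * ∑ j, a i j z * r j z := by
        rw [h1 i, h3 i]
      have h5 : ∑ j, (q z)ᴴ i j * v z j = (Real.exp (-phase ω z / h) : ℂ) *
          ((∑ j, a i j z * amplitude ζ K₁ z j) +
            Complex.exp (-(z.1 : ℂ)) * ((h : ℂ) * ∑ j, a i j z * r j z)) := by
        rw [Finset.mul_sum, Finset.mul_sum, ← Finset.sum_add_distrib, Finset.mul_sum]
        refine Finset.sum_congr rfl fun j _ => ?_
        rw [← h2 i j]
        simp only [v, R, Pi.smul_apply, Pi.add_apply, smul_eq_mul, hℓ₀]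
        ring
      have h6 : (h : ℂ) * (Complex.exp (ℓ z) * Y i z) = Complex.exp (ℓ z) * ((h : ℂ) * Y i z) := by
        ring
      have h7 : Complex.exp (-(z.1 : ℂ)) * Complex.exp z.1 = 1 := by
        rw [← Complex.exp_add, neg_add_cancel, Complex.exp_zero]
      have h8 : amplitude ζ K₁ z i = Complex.exp (-Complex.I * (spaceTimeInner ζ z : ℂ)) * K₁ i := rfl
      rw [h5, h6, h4, hexp, hexp₁]
      simp only [h8]
      -- The factor `e^t` of the source meets the `e^{-t}` of the conjugation and cancels the error
      -- of the leading term, while the two coupling terms in `r` cancel each other.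
      linear_combination (-(Real.exp (-phase ω z / h) : ℂ) *
        (κ * (Complex.exp (-Complex.I * (spaceTimeInner ζ z : ℂ)) * K₁ i) +
          ∑ j, a i j z * amplitude ζ K₁ z j)) * h7
  · refine Real.sqrt_le_sqrt ?_
    calc ∑ j, ∫ z in Q, ‖R z j‖ ^ 2 ≤ ∑ _j : Fin n, (2 * ‖f‖) ^ 2 := by
          refine Finset.sum_le_sum fun j _ => le_trans ?_ (hrn j)
          refine integral_mono_of_nonneg (ae_of_all _ fun z => by positivity)
            (hrH j).memLp.norm.integrable_sq ?_
          filter_upwards [ae_restrict_mem hQ.measurableSet] with z hz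
          have h1 : ‖R z j‖ ≤ ‖r j z‖ := by
            simp only [R]
            rw [norm_mul, hℓ₀, ← Complex.ofReal_neg, Complex.norm_exp_ofReal]
            have : Real.exp (-z.1) ≤ 1 := Real.exp_le_one_iff.2 (by linarith [hz.1.1])
            exact mul_le_of_le_one_left (norm_nonneg _) this
          exact pow_le_pow_left₀ (norm_nonneg _) h1 2
      _ = n * (2 * ‖f‖) ^ 2 := by simp
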